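/- **Theorem (robust spectral density estimation).** Conventions: for a real symmetric matrix $A\in\mathbb R^{n\times n}$ ($n\ge 1$) with eigenvalues $\lambda_1,\dots,\lambda_n$, the spectral density is $s=\frac1n\sum_{i=1}^n\delta_{\lambda_i}$. The Wasserstein-1 distance is $W_1(s,q)=\sup_f\{\int f\,ds-\int_{-1}^1 f(x)q(x)\,dx\}$ over all 1-Lipschitz $f:\mathbb R\to\mathbb R$. An $\epsilon_{MV}$-approximate matrix-vector multiplication oracle for $A$ answers every query $y\in\mathbb R^n$ with some vector $z=\mathrm{AMV}(y)$ satisfying $\|z-Ay\|_2\le\epsilon_{MV}\|A\|_2\|y\|_2$; answers may depend on earlier queries. $T_k$ are the Chebyshev polynomials of the first kind, $w(x)=1/\sqrt{1-x^2}$, and $\bar T_k=T_k/\big(\int_{-1}^1 wT_k^2\big)^{1/2}$. For $N\in 4\mathbb N^+$ and $0\le k\le N$ let $\hat b_N[k]=\sum_{j=-N/2-1}^{N/2+1-k}\big(\tfrac N2+1-|j|\big)\big(\tfrac N2+1-|j+k|\big)$. *Jackson damped kernel polynomial method with degree $N$ and $m$ repetitions:* for $i=1,\dots,m$ draw $g=g^{(i)}$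 uniformly from $\{-1,1\}^n$, put $\tilde v_0=g$, $\tilde v_1=\mathrm{AMV}(g)$ and $\tilde v_k=2\,\mathrm{AMV}(\tilde v_{k-1})-\tilde v_{k-2}$ for $2\le k\le N$, and record $\tilde\tau_{k,i}=g^\top\tilde v_k$. Set $\tilde\tau_0=1/\sqrt\pi$ and $\tilde\tau_k=\frac{\sqrt{2/\pi}}{mn}\sum_{i=1}^m\tilde\tau_{k,i}$ for $1\le k\le N$; put $\tilde s_N=w\sum_{k=0}^N\frac{\hat b_N[k]}{\hat b_N[0]}\tilde\tau_k\bar T_k$ and return $q=\big(\tilde s_N+\frac{w\sqrt2}{N\sqrt\pi}\big)\big/\big(1+\frac{\sqrt{2\pi}}N\big)$, represented by the coefficients $\frac{\hat b_N[k]}{\hat b_N[0]}\tilde\tau_k$, $0\le k\le N$. Additional running time is counted in arithmetic operations (including square roots), loads of constants and coin tosses on real numbers; an oracle call is charged $n$ steps for handling its answer, and the work inside the oracle is not counted. *Claim.* There are absolute constants $C,C'>0$, $0<C''<1$, $K>0$ and positive integers $\kappa,\rho$ such that the following holds for all $n\ge1$ and $\epsilon,\delta\in(0,1)$. Put $\ell=\max\left(1,\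 \frac{C'}n\epsilon^{-4}\log^2\frac1{\epsilon\delta}\right)$, $N=4\kappa\lceil1/\epsilon\rceil$, $m=\rho\lceil\ell\rceil$ and $\epsilon_{MV}=C''\epsilon^4$. The method above, with degree $N$ and $m$ repetitions, makes at most $C\ell/\epsilon$ oracle calls and uses at most $K\,n\ell/\epsilon$ additional running time. For every real symmetric $A\in\mathbb R^{n\times n}$ with $\|A\|_2\le1$ and spectral density $s$, and every $\epsilon_{MV}$-approximate matrix-vector multiplication oracle for $A$, the returned function $q$ is a probability density on $[-1,1]$, and $W_1(s,q)\le\epsilon$ with probability at least $1-\delta$ over the coin tosses. -/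

import Mathlib

noncomputable section

namespace KPM

open MeasureTheory Set

/-! ### Matrices, spectral densities and the Wasserstein-1 distance -/

/-- `ℝⁿ` with the Euclidean norm. -/
abbrev Vec (n : ℕ) : Type := EuclideanSpace ℝ (Fin n)

/-- The linear map `y ↦ A y` on `ℝⁿ`; its norm is the operator norm `‖A‖₂`. -/
abbrev mulCLM {n : ℕ} (A : Matrix (Fin n) (Fin n) ℝ) : Vec n →L[ℝ] Vec n :=
  Matrix.toEuclideanCLM (n := Fin n) (𝕜 := ℝ) A

/-- The spectral density `s = (1/n) ∑ᵢ δ_{λᵢ}` of a Hermitian matrix, as a measure on `ℝ`. -/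
def spectralDensity {n : ℕ} {A : Matrix (Fin n) (Fin n) ℝ} (hA : A.IsHermitian) : Measure ℝ :=
  (n : ENNReal)⁻¹ • ∑ i : Fin n, Measure.dirac (hA.eigenvalues i)

/-- Wasserstein-1 distance in its dual form:
the supremum of `∫ f dμ - ∫ f dν` over all 1-Lipschitz `f : ℝ → ℝ`. The supremum is taken in
`[0, ∞]`; nothing is lost by that since `f = 0` contributes the value `0`. -/
def W1 (μ ν : Measure ℝ) : ENNReal :=
  ⨆ (f : ℝ → ℝ) (_ : LipschitzWith 1 f), ENNReal.ofReal (∫ x, f x ∂μ - ∫ x, f x ∂ν)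

/-- `q` is a probability density function on `[-1, 1]`. -/
structure IsDensity (q : ℝ → ℝ) : Prop where
  nonneg : ∀ x ∈ Icc (-1 : ℝ) 1, 0 ≤ q x
  integrable : IntegrableOn q (Icc (-1) 1)
  integral_eq_one : ∫ x in Icc (-1 : ℝ) 1, q x = 1

/-- The measure on `ℝ`, supported on `[-1, 1]`, with Lebesgue density `q`. -/
def densityMeasure (q : ℝ → ℝ) : Measure ℝ :=
  (volume.restrict (Icc (-1) 1)).withDensity (fun x => ENNReal.ofReal (q x))

/-! ### Normalized Chebyshev polynomials -/

/-- The Chebyshev weight `w(x) = 1 / √(1 - x²)`. -/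
def weight (x : ℝ) : ℝ := 1 / √(1 - x ^ 2)

/-- The Chebyshev polynomial of the first kind `T_k`. -/
def cheb (k : ℕ) (x : ℝ) : ℝ := (Polynomial.Chebyshev.T ℝ (k : ℤ)).eval x

/-- The normalized Chebyshev polynomial `T_k / √⟨T_k, w T_k⟩`. -/
def chebBar (k : ℕ) (x : ℝ) : ℝ :=
  cheb k x / √(∫ y in (-1 : ℝ)..1, cheb k y * (weight y * cheb k y))

/-- The function represented by the coefficients `a 0, …, a N` that the kernel polynomial method
computes: with `s̃ = w ∑ₖ aₖ T̄ₖ`, it is `(s̃ + w √2 / (N √π)) / (1 + √(2π) / N)`. -/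
def outputDensity (N : ℕ) (a : ℕ → ℝ) (x : ℝ) : ℝ :=
  (weight x * ∑ k ∈ Finset.range (N + 1), a k * chebBar k x
      + weight x * √2 / (N * √Real.pi))
    / (1 + √(2 * Real.pi) / N)

/-! ### Approximate matrix-vector multiplication oracles -/

/-- A matrix-vector oracle: it receives the list of all earlier queries (latest first) and the
current query, and answers with a vector. So answers may depend on everything asked before, and
equal queries may be answered differently. -/
abbrev Oracle (n : ℕ) : Type := List (Vec n) → Vec n → Vec n

/-- `O` is an `εMV`-approximate matrix-vector multiplication oracle for `A`: every answer `z` to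
a query `y` satisfies `‖z - A y‖₂ ≤ εMV ‖A‖₂ ‖y‖₂`. -/
def IsAMV {n : ℕ} (A : Matrix (Fin n) (Fin n) ℝ) (εMV : ℝ) (O : Oracle n) : Prop :=
  ∀ (past : List (Vec n)) (y : Vec n),
    ‖O past y - mulCLM A y‖ ≤ εMV * ‖mulCLM A‖ * ‖y‖

/-! ### A real RAM with fair coins and a matrix-vector oracle

The memory consists of arrays of real cells. A program is a finite sequence of instructions.
Instructions name cells only, so every operation on real data is an instruction and is paid for. -/

/-- Names of the arrays. -/
inductive Arr : Type
  | v (k : ℕ)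
  | w
  | tau
  | b
  | a
  | tmp
  deriving DecidableEq

/-- A memory cell: an array and a position in it. -/
abbrev Cell : Type := Arr × ℕ

/-- Instructions. The first argument is the cell (the array, for `amv`) written to. -/
inductive Instr : Type
  /-- load a natural number -/
  | lit (d : Cell) (c : ℕ)
  /-- load the constant `π` -/
  | pi (d : Cell)
  | add (d x y : Cell)
  | sub (d x y : Cell)
  | mul (d x y : Cell)
  | div (d x y : Cell)
  | sqrt (d x : Cell)
  /-- toss a fair coin and store `1` or `-1` -/
  | coin (d : Cell)
  /-- oracle call: the query is the vector in array `x`, the answer is stored in array `d` -/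
  | amv (d x : Arr)

/-- Programs. -/
abbrev Prog : Type := List Instr

/-- Running time of an instruction in dimension `n`: one step for every scalar instruction,
`n` steps for handling the `n` entries of the answer of an oracle call (the work
done inside the oracle is not counted). -/
def Instr.cost (n : ℕ) : Instr → ℕ
  | .amv _ _ => n
  | _ => 1

/-- Number of oracle calls of an instruction. -/
def Instr.calls : Instr → ℕ
  | .amv _ _ => 1
  | _ => 0

/-- Running time of a program, apart from the work done inside the oracle. -/
def Prog.steps (n : ℕ) (P : Prog) : ℕ := (P.map (Instr.cost n)).sum

/-- Number of oracle calls of a program. -/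
def Prog.calls (P : Prog) : ℕ := (P.map Instr.calls).sum

/-- Configurations: memory contents, number of coins tossed, past oracle queries. -/
structure Config (n : ℕ) : Type where
  mem : Arr → ℕ → ℝ
  coins : ℕ
  past : List (Vec n)

/-- Write a real number to a cell. -/
def Config.write {n : ℕ} (c : Config n) (d : Cell) (r : ℝ) : Config n :=
  { c with mem := fun X j => if X = d.1 ∧ j = d.2 then r else c.mem X j }

/-- Read a cell. -/
def Config.read {n : ℕ} (c : Config n) (x : Cell) : ℝ := c.mem x.1 x.2

/-- The vector of the first `n` entries of an array. -/
def Config.vec {n : ℕ} (c : Config n) (X : Arr) : Vec n :=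
  WithLp.toLp 2 (fun j : Fin n => c.mem X j)

/-- Write a vector to the first `n` entries of an array and record the query `y`. -/
def Config.answer {n : ℕ} (c : Config n) (d : Arr) (y z : Vec n) : Config n :=
  { c with
    mem := fun X j => if h : X = d ∧ j < n then z ⟨j, h.2⟩ else c.mem X j
    past := y :: c.past }

/-- Execution of one instruction with the oracle `O` and the coin tosses `ω`. -/
def exec {n : ℕ} (O : Oracle n) (ω : ℕ → Bool) (c : Config n) : Instr → Config n
  | .lit d k => c.write d k
  | .pi d => c.write d Real.pi
  | .add d x y => c.write d (c.read x + c.read y)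
  | .sub d x y => c.write d (c.read x - c.read y)
  | .mul d x y => c.write d (c.read x * c.read y)
  | .div d x y => c.write d (c.read x / c.read y)
  | .sqrt d x => c.write d (√(c.read x))
  | .coin d => { c.write d (if ω c.coins then 1 else -1) with coins := c.coins + 1 }
  | .amv d x => c.answer d (c.vec x) (O c.past (c.vec x))

/-- Execution of a program, from a memory full of zeros. -/
def run {n : ℕ} (O : Oracle n) (ω : ℕ → Bool) (P : Prog) : Config n :=
  P.foldl (exec O ω) { mem := fun _ _ => 0, coins := 0, past := [] }

/-- The law of an infinite sequence of independent fair coin tosses. -/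
def coinLaw : Measure (ℕ → Bool) :=
  Measure.infinitePi (fun _ : ℕ => (PMF.uniformOfFintype Bool).toMeasure)

/-! ### Hutchinson's moment estimator with approximate multiplications -/

/-- `for i = 0, …, k - 1 do body i`. -/
def forLoop (k : ℕ) (body : ℕ → Prog) : Prog := (List.range k).flatMap body

/-- Draw `g = ṽ₀` uniformly from `{-1, 1}ⁿ`. -/
def drawSigns (n : ℕ) : Prog := forLoop n fun j => [.coin (.v 0, j)]

/-- Add `gᵀ ṽ_k` to `τ̃_k`, where `g = ṽ₀`. -/
def addMoment (n k : ℕ) : Prog :=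
  forLoop n fun j =>
    [.mul (.tmp, 0) (.v 0, j) (.v k, j),
     .add (.tau, k) (.tau, k) (.tmp, 0)]

/-- `ṽ_k ← 2 AMV(A, ṽ_{k-1}) - ṽ_{k-2}`. -/
def recurrenceStep (n k : ℕ) : Prog :=
  .amv .w (.v (k - 1)) ::
    forLoop n fun j =>
      [.lit (.tmp, 0) 2,
       .mul (.tmp, 0) (.tmp, 0) (.w, j),
       .sub (.v k, j) (.tmp, 0) (.v (k - 2), j)]

/-- One repetition of the estimator: draw `g`, run the three-term recurrence, add up moments. -/
def repetition (n N : ℕ) : Prog :=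
  drawSigns n ++
  [.amv (.v 1) (.v 0)] ++
  addMoment n 1 ++
  forLoop (N - 1) fun i => recurrenceStep n (i + 2) ++ addMoment n (i + 2)

/-- `τ̃_k ← √(2/π) / (m n) * τ̃_k`. -/
def scaleMoment (n m k : ℕ) : Prog :=
  [.lit (.tmp, 0) 2,
   .pi (.tmp, 1),
   .div (.tmp, 0) (.tmp, 0) (.tmp, 1),
   .sqrt (.tmp, 0) (.tmp, 0),
   .lit (.tmp, 1) m,
   .div (.tmp, 0) (.tmp, 0) (.tmp, 1),
   .lit (.tmp, 1) n,
   .div (.tmp, 0) (.tmp, 0) (.tmp, 1),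
   .mul (.tau, k) (.tmp, 0) (.tau, k)]

/-- Hutchinson's estimator with `m` repetitions: approximations `τ̃₁, …, τ̃_N` of the normalized
Chebyshev moments `tr(T̄_k(A)) / n`. -/
def momentEstimator (n N m : ℕ) : Prog :=
  (forLoop N fun i => [.lit (.tau, i + 1) 0]) ++
  (forLoop m fun _ => repetition n N) ++
  (forLoop N fun i => scaleMoment n m (i + 1))

/-! ### The Jackson damped kernel polynomial method -/

/-- `b_k ← ∑_{j = -N/2-1}^{N/2+1-k} (N/2 + 1 - |j|) (N/2 + 1 - |j + k|)`, the Jackson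
coefficient; `j` is written as `i - (N/2 + 1)` with `i = 0, …, N + 2 - k`
(here `N` is a multiple of `4` and `k ≤ N`). -/
def jacksonCoeff (N k : ℕ) : Prog :=
  .lit (.b, k) 0 ::
    forLoop (N + 3 - k) fun i =>
      let j : ℤ := i - (N / 2 + 1 : ℕ)
      [.lit (.tmp, 0) (N / 2 + 1 - j.natAbs),
       .lit (.tmp, 1) (N / 2 + 1 - (j + k).natAbs),
       .mul (.tmp, 0) (.tmp, 0) (.tmp, 1),
       .add (.b, k) (.b, k) (.tmp, 0)]

/-- `τ̃₀ ← 1 / √π`. -/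
def zerothMoment : Prog :=
  [.pi (.tmp, 0),
   .sqrt (.tmp, 0) (.tmp, 0),
   .lit (.tmp, 1) 1,
   .div (.tau, 0) (.tmp, 1) (.tmp, 0)]

/-- `a_k ← (b_k / b_0) τ̃_k`. -/
def dampedCoeff (k : ℕ) : Prog :=
  [.div (.tmp, 0) (.b, k) (.b, 0),
   .mul (.a, k) (.tmp, 0) (.tau, k)]

/-- The Jackson damped kernel polynomial method with degree parameter `N` for an `n × n` matrix,
with `m` repetitions of the approximate Hutchinson estimator as its moment subroutine.
Its output are the entries `0, …, N` of the array `a`. -/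
def kpm (n N m : ℕ) : Prog :=
  momentEstimator n N m ++
  zerothMoment ++
  (forLoop (N + 1) fun k => jacksonCoeff N k) ++
  (forLoop (N + 1) fun k => dampedCoeff k)

/-- The function on `[-1, 1]` that the kernel polynomial method returns. -/
def kpmDensity {n : ℕ} (N m : ℕ) (O : Oracle n) (ω : ℕ → Bool) : ℝ → ℝ :=
  outputDensity N (fun k => (run O ω (kpm n N m)).mem .a k)

/-- `ℓ = max (1, (C' / n) ε⁻⁴ log² (1 / (ε δ)))`. -/
def repCount (C' : ℝ) (n : ℕ) (ε δ : ℝ) : ℝ :=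
  max 1 (C' / n * (ε ^ 4)⁻¹ * Real.log (1 / (ε * δ)) ^ 2)

/-- The degree parameter `N = 4 κ ⌈1/ε⌉`. -/
def degree (κ : ℕ) (ε : ℝ) : ℕ := 4 * κ * ⌈1 / ε⌉₊

/-- The number of repetitions `ρ ⌈ℓ⌉`. -/
def repetitions (ρ : ℕ) (C' : ℝ) (n : ℕ) (ε δ : ℝ) : ℕ := ρ * ⌈repCount C' n ε δ⌉₊

end KPM

end

/-! The Jackson kernel `kern` becomes, under x = cos s and y = cos t, a normalized sum of two
squared Fejér kernels. It is therefore nonnegative. It has mass one, and its second moment about y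
is O(1/N²), since (x - y)² involves only T_0, T_1, T_2. Smearing a point mass with it changes the
integral of a 1-Lipschitz function by O(1/N) (`abs_integral_kern_sub_le`). The returned function is
such a smearing of weights p_j at the eigenvalues, plus an error from inexact moments, plus a
positive shift, normalized. If the normalized moments of the weights are met within 1/N², the error
is pointwise at most the shift. The output is then a density within O(1/N) of ∑ p_j δ_{λ_j}
(`isDensity_outputDensity`, `abs_sub_integral_outputDensity_le`).

This robustness is applied to two choices of weights. Since ‖g‖² = n, the exact Hutchinson sums are
themselves moments of the probability weights p_j = (mn)⁻¹ ∑_i ⟨u_j, g_i⟩². Relative to these only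
the oracle error counts, so the output is a density for every outcome of the coins. Relative to p_j
= 1/n the deviation of Hutchinson's estimator is added, and this gives closeness to the spectral
density with high probability.

Oracle errors enter the three-term recurrence as residuals and are propagated by U_k. Since |U_k| ≤
k + 1 on [-1, 1], the relative error of a moment is O(N² ε_MV), which is below 1/N² when ε_MV is a
small multiple of ε⁴ (`norm_recurrence_sub_le`).

For the deviation, the spectral coordinates of the signs form a jointly subgaussian vector, and
Gaussian linearization of squares bounds the exponential moments of positive semidefinite forms in
it (`lintegral_exp_sum_mul_sq_le`). As ∑_j (⟨u_j, g⟩² - 1) = 0, the identity can be added to any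
form at no cost, so semidefinite forms suffice (`coinLaw_hutchinson_le`). The tail exp(-mn t²/64) at
t = 1/(2N²), with a union bound over N moments, dictates mn of order ε⁻⁴ log(1/(εδ)), which ℓ
supplies up to constants. Loop invariants identify what the program computes with these quantities.
-/

noncomputable section

namespace KPM

open MeasureTheory Set

/-! ### Jackson coefficients -/

/-- The triangle sequence `max (M - |j|) 0`. -/
def tri (M : ℕ) (j : ℤ) : ℝ := ((M - j.natAbs : ℕ) : ℝ)

lemma tri_neg (M : ℕ) (j : ℤ) : tri M (-j) = tri M j := by simp [tri]

lemma tri_eq_zero {M : ℕ} {j : ℤ} (h : M ≤ j.natAbs) : tri M j = 0 := by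
  simp [tri, Nat.sub_eq_zero_of_le h]

/-- Autocorrelation of the triangle sequence. -/
def autocorr (M : ℕ) (k : ℤ) : ℝ := ∑ j ∈ Finset.Icc (-M : ℤ) M, tri M j * tri M (j + k)

lemma sum_Icc_shift (f : ℤ → ℝ) (a b k : ℤ) :
    ∑ j ∈ Finset.Icc a b, f (j + k) = ∑ j ∈ Finset.Icc (a + k) (b + k), f j := by
  rw [← Finset.image_add_right_Icc, Finset.sum_image (by simp)]

lemma sum_Icc_neg (f : ℤ → ℝ) (a : ℤ) :
    ∑ j ∈ Finset.Icc (-a) a, f (-j) = ∑ j ∈ Finset.Icc (-a) a, f j := by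
  refine Finset.sum_nbij' (fun j => -j) (fun j => -j) ?_ ?_ ?_ ?_ ?_ <;>
    simp only [Finset.mem_Icc] <;> intros <;> first | omega | rfl | simp

/-- Lets summation windows be exchanged freely: only the support of the triangle sequence matters.
-/
lemma sum_Icc_eq_of_support {f : ℤ → ℝ} {a b a' b' : ℤ}
    (h : ∀ j, f j ≠ 0 → (a ≤ j ∧ j ≤ b) ∧ a' ≤ j ∧ j ≤ b') :
    ∑ j ∈ Finset.Icc a b, f j = ∑ j ∈ Finset.Icc a' b', f j := by
  refine Finset.sum_bij_ne_zero (fun j _ _ => j) ?_ ?_ ?_ ?_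
  · intro j _ hj; exact Finset.mem_Icc.2 (h j hj).2
  · intros; assumption
  · intro j _ hj; exact ⟨j, Finset.mem_Icc.2 (h j hj).1, hj, rfl⟩
  · intros; rfl

lemma natAbs_lt_of_tri_ne_zero {M : ℕ} {j : ℤ} (h : tri M j ≠ 0) : j.natAbs < M := by
  by_contra hc
  exact h (tri_eq_zero (by omega))

lemma autocorr_neg (M : ℕ) (k : ℤ) : autocorr M (-k) = autocorr M k := by
  unfold autocorr
  rw [← sum_Icc_neg]
  refine Finset.sum_congr rfl fun j _ => ?_
  rw [tri_neg, ← tri_neg M (-j + -k)]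
  congr 2; ring

/-- The supports |j| < M and |j + k| < M meet only if |k| ≤ 2M - 2. For M = N/2 + 1 this makes the
degree exactly N. -/
lemma autocorr_eq_zero {M : ℕ} {k : ℤ} (h : 2 * M - 1 ≤ k.natAbs) : autocorr M k = 0 := by
  refine Finset.sum_eq_zero fun j _ => ?_
  by_contra hc
  have h1 := natAbs_lt_of_tri_ne_zero (left_ne_zero_of_mul hc)
  have h2 := natAbs_lt_of_tri_ne_zero (right_ne_zero_of_mul hc)
  omega

lemma sum_Icc_symm_succ (f : ℤ → ℝ) (L : ℕ) :
    ∑ j ∈ Finset.Icc (-L : ℤ) L, f j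
      = f 0 + ∑ i ∈ Finset.range L, (f (i + 1 : ℕ) + f (-(i + 1 : ℕ))) := by
  induction L with
  | zero => simp
  | succ L ih =>
    rw [Finset.sum_range_succ, ← add_assoc, ← ih]
    have : Finset.Icc (-(L + 1 : ℕ) : ℤ) (L + 1 : ℕ)
        = insert ((L + 1 : ℕ) : ℤ) (insert (-(L + 1 : ℕ) : ℤ) (Finset.Icc (-L : ℤ) L)) := by
      ext j; simp only [Finset.mem_Icc, Finset.mem_insert]; omega
    rw [this, Finset.sum_insert (by simp; omega), Finset.sum_insert (by simp)]
    ring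

/-- The Fejér kernel (up to normalization). -/
def fejer (M : ℕ) (t : ℝ) : ℝ := ∑ j ∈ Finset.Icc (-M : ℤ) M, tri M j * Real.cos (j * t)

/-- `fejer` is the whole of ∑ tri(j) e^{ijt}, whose imaginary part vanishes by evenness. Its square
is thus a squared modulus, a double sum of cos((l - j)t) that is grouped by k = l - j. -/
lemma fejer_sq_eq_sum_Icc (M : ℕ) (t : ℝ) :
    fejer M t ^ 2 = ∑ k ∈ Finset.Icc (-(2 * M : ℕ) : ℤ) (2 * M : ℕ),
      autocorr M k * Real.cos (k * t) := by
  have hodd : ∑ j ∈ Finset.Icc (-M : ℤ) M, tri M j * Real.sin (j * t) = 0 := by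
    have h := sum_Icc_neg (fun j : ℤ => tri M j * Real.sin (j * t)) M
    simp only [tri_neg, Int.cast_neg, neg_mul, Real.sin_neg, mul_neg, Finset.sum_neg_distrib] at h
    linarith
  have h1 : fejer M t ^ 2 = ∑ j ∈ Finset.Icc (-M : ℤ) M, ∑ l ∈ Finset.Icc (-M : ℤ) M,
      tri M j * (tri M l * Real.cos ((l - j : ℤ) * t)) := by
    have h2 : fejer M t ^ 2 = fejer M t * fejer M t +
        (∑ j ∈ Finset.Icc (-M : ℤ) M, tri M j * Real.sin (j * t)) *
        (∑ j ∈ Finset.Icc (-M : ℤ) M, tri M j * Real.sin (j * t)) := by rw [hodd]; ring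
    rw [h2, fejer, Finset.sum_mul_sum, Finset.sum_mul_sum, ← Finset.sum_add_distrib]
    refine Finset.sum_congr rfl fun j _ => ?_
    rw [← Finset.sum_add_distrib]
    refine Finset.sum_congr rfl fun l _ => ?_
    push_cast
    rw [sub_mul, Real.cos_sub]
    ring
  rw [h1]
  simp only [autocorr, Finset.sum_mul]
  rw [Finset.sum_comm (s := Finset.Icc (-(2 * M : ℕ) : ℤ) (2 * M : ℕ))]
  refine Finset.sum_congr rfl fun j hj => ?_
  rw [Finset.mem_Icc] at hj
  have h3 := sum_Icc_shift (fun l : ℤ => tri M j * (tri M l * Real.cos ((l - j : ℤ) * t)))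
    (-(2 * M : ℕ)) (2 * M : ℕ) j
  calc _ = ∑ l ∈ Finset.Icc (-(2 * M : ℕ) + j : ℤ) ((2 * M : ℕ) + j),
        tri M j * (tri M l * Real.cos ((l - j : ℤ) * t)) := by
        refine sum_Icc_eq_of_support fun l hl => ?_
        have := natAbs_lt_of_tri_ne_zero (left_ne_zero_of_mul (right_ne_zero_of_mul hl))
        push_cast; omega
    _ = _ := by
        rw [← h3]
        refine Finset.sum_congr rfl fun k _ => ?_
        rw [add_comm k j, add_sub_cancel_left]; ring

/-- The square of the Fejér kernel is a cosine polynomial with coefficients `autocorr`. -/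
lemma fejer_sq (M : ℕ) (t : ℝ) :
    fejer (M + 1) t ^ 2 = autocorr (M + 1) 0 + 2 * ∑ i ∈ Finset.range (2 * M),
      autocorr (M + 1) (i + 1 : ℕ) * Real.cos ((i + 1 : ℕ) * t) := by
  rw [fejer_sq_eq_sum_Icc, sum_Icc_symm_succ, Finset.mul_sum, show 2 * (M + 1) = 2 * M + 1 + 1 by ring,
    Finset.sum_range_succ, Finset.sum_range_succ]
  -- The window reaches 2(M + 1); its last two coefficients vanish, which leaves degree 2M.
  have h1 : autocorr (M + 1) (2 * M + 1 : ℕ) = 0 := autocorr_eq_zero (by omega)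
  have h2 : autocorr (M + 1) (2 * M + 1 + 1 : ℕ) = 0 := autocorr_eq_zero (by omega)
  simp only [autocorr_neg, Int.cast_neg, neg_mul, Real.cos_neg, Int.cast_natCast, Int.cast_zero,
    zero_mul, Real.cos_zero, mul_one, add_zero, h1, h2]
  congr 1
  exact Finset.sum_congr rfl fun i _ => by ring

lemma autocorr_zero (M : ℕ) : autocorr M 0 = M * (2 * M ^ 2 + 1) / 3 := by
  have h : ∀ K : ℕ, ∑ i ∈ Finset.range K, ((i : ℝ)) ^ 2 = K * (K - 1) * (2 * K - 1) / 6 := by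
    intro K
    induction K with
    | zero => simp
    | succ K ih => rw [Finset.sum_range_succ, ih]; push_cast; ring
  have h2 : ∑ i ∈ Finset.range M, tri M (i + 1 : ℕ) ^ 2 = ∑ i ∈ Finset.range M, ((i : ℝ)) ^ 2 := by
    rw [← Finset.sum_range_reflect]
    refine Finset.sum_congr rfl fun i hi => ?_
    rw [Finset.mem_range] at hi
    congr 1
    simp only [tri, Int.natAbs_natCast]
    congr 1; omega
  unfold autocorr
  rw [sum_Icc_symm_succ]
  simp only [add_zero, tri_neg, ← two_mul, ← pow_two, ← Finset.mul_sum]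
  rw [h2, h]
  simp [tri]
  ring

lemma autocorr_eq_sum_of_le {M : ℕ} {k : ℤ} {a b : ℤ} (ha : a ≤ -M) (hb : M ≤ b) :
    autocorr M k = ∑ j ∈ Finset.Icc a b, tri M j * tri M (j + k) := by
  refine sum_Icc_eq_of_support fun j hj => ?_
  have := natAbs_lt_of_tri_ne_zero (left_ne_zero_of_mul hj)
  omega

/-- Polarization: 2ab = a² + b² - (a - b)², and both sums of squares equal `autocorr M 0`. It yields
damping factors at most 1 and also their closeness to 1. -/
lemma autocorr_zero_sub_eq (M k : ℕ) :
    2 * (autocorr M 0 - autocorr M k)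
      = ∑ j ∈ Finset.Icc (-M - k : ℤ) M, (tri M j - tri M (j + k)) ^ 2 := by
  have h1 : autocorr M 0 = ∑ j ∈ Finset.Icc (-M - k : ℤ) M, tri M (j + k) ^ 2 := by
    rw [sum_Icc_shift (fun j => tri M j ^ 2), autocorr]
    simp only [add_zero, ← pow_two]
    refine sum_Icc_eq_of_support fun j hj => ?_
    have := natAbs_lt_of_tri_ne_zero (ne_zero_pow two_ne_zero hj)
    omega
  have h2 : autocorr M 0 = ∑ j ∈ Finset.Icc (-M - k : ℤ) M, tri M j ^ 2 := by
    rw [autocorr_eq_sum_of_le (a := -M - k) (b := M) (by omega) le_rfl]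
    simp [pow_two]
  have h3 : autocorr M k = ∑ j ∈ Finset.Icc (-M - k : ℤ) M, tri M j * tri M (j + k) :=
    autocorr_eq_sum_of_le (by omega) le_rfl
  calc _ = autocorr M 0 + autocorr M 0 - 2 * autocorr M k := by ring
    _ = _ := by
      nth_rw 1 [h1]
      rw [h2, h3, Finset.mul_sum, ← Finset.sum_add_distrib, ← Finset.sum_sub_distrib]
      exact Finset.sum_congr rfl fun j _ => by ring

/-- The triangle sequence is 1-Lipschitz, so each of the 2M + k + 1 squares is at most k². -/
lemma autocorr_zero_sub_le (M k : ℕ) :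
    2 * (autocorr M 0 - autocorr M k) ≤ (k : ℝ) ^ 2 * (2 * M + k + 1) := by
  rw [autocorr_zero_sub_eq]
  have h5 : ∀ j ∈ Finset.Icc (-M - k : ℤ) M, (tri M j - tri M (j + k)) ^ 2 ≤ (k : ℝ) ^ 2 := by
    intro j _
    rw [sq_le_sq, abs_of_nonneg (Nat.cast_nonneg k : (0 : ℝ) ≤ k), abs_le, tri, tri]
    have e1 : M - j.natAbs ≤ k + (M - (j + k).natAbs) := by omega
    have e2 : M - (j + k).natAbs ≤ k + (M - j.natAbs) := by omega
    have e1' : ((M - j.natAbs : ℕ) : ℝ) ≤ k + (M - (j + k).natAbs : ℕ) := by exact_mod_cast e1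
    have e2' : ((M - (j + k).natAbs : ℕ) : ℝ) ≤ k + (M - j.natAbs : ℕ) := by exact_mod_cast e2
    constructor <;> linarith
  refine (Finset.sum_le_sum h5).trans (le_of_eq ?_)
  rw [Finset.sum_const, Int.card_Icc, nsmul_eq_mul, mul_comm,
    show ((M : ℤ) + 1 - (-M - k)).toNat = 2 * M + k + 1 by omega]
  push_cast; ring

/-- The Jackson coefficient `b̂_N[k]`, with the sum written as in `jacksonCoeff`. -/
def jackson (N k : ℕ) : ℝ :=
  ∑ i ∈ Finset.range (N + 3 - k),
    tri (N / 2 + 1) (i - (N / 2 + 1 : ℕ)) * tri (N / 2 + 1) (i - (N / 2 + 1 : ℕ) + k)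

/-- The index is j = i - (L + 1) and stops at L + 1 - k, beyond which the second factor vanishes. -/
lemma jackson_eq_autocorr {L k : ℕ} (hk : k ≤ 2 * L) :
    jackson (2 * L) k = autocorr (L + 1) k := by
  have hL : 2 * L / 2 = L := by omega
  unfold jackson
  rw [hL]
  have h : ∀ (K : ℕ) (f : ℤ → ℝ), ∑ i ∈ Finset.range K, f (i - (L + 1 : ℕ))
      = ∑ j ∈ Finset.Icc (-(L + 1 : ℕ) : ℤ) (K - 1 - (L + 1 : ℕ)), f j := by
    intro K f
    refine Finset.sum_nbij' (fun i => (i : ℤ) - (L + 1 : ℕ)) (fun j => (j + (L + 1 : ℕ)).toNat)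
      ?_ ?_ ?_ ?_ ?_ <;> simp only [Finset.mem_Icc, Finset.mem_range]
    · omega
    · omega
    · omega
    · omega
    · intros; trivial
  rw [h _ fun j => tri (L + 1) j * tri (L + 1) (j + k)]
  refine sum_Icc_eq_of_support fun j hj => ?_
  have := natAbs_lt_of_tri_ne_zero (left_ne_zero_of_mul hj)
  have := natAbs_lt_of_tri_ne_zero (right_ne_zero_of_mul hj)
  omega

/-- The damping factor `b̂_N[k] / b̂_N[0]`. -/
def damping (N k : ℕ) : ℝ := jackson N k / jackson N 0

lemma jackson_zero_pos {L : ℕ} : 0 < jackson (2 * L) 0 := by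
  rw [jackson_eq_autocorr (by omega), Int.natCast_zero, autocorr_zero]
  positivity

lemma damping_zero {L : ℕ} : damping (2 * L) 0 = 1 := div_self jackson_zero_pos.ne'

lemma damping_nonneg {N k : ℕ} : 0 ≤ damping N k := by
  have h : ∀ k, 0 ≤ jackson N k := fun k =>
    Finset.sum_nonneg fun i _ => mul_nonneg (Nat.cast_nonneg _) (Nat.cast_nonneg _)
  exact div_nonneg (h _) (h _)

/-- The normalizer is at least 2(L + 1)³/3, so for fixed k this is O(1/L²). The factor 3/(4(L + 1)³)
is one half divided by that bound. -/
lemma one_sub_damping_le {L k : ℕ} (hk : k ≤ 2 * L) :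
    1 - damping (2 * L) k ≤ (k : ℝ) ^ 2 * (2 * (L + 1) + k + 1) * (3 / (4 * (L + 1) ^ 3)) := by
  have h0 := @jackson_zero_pos L
  have h1 := autocorr_zero_sub_le (L + 1) k
  have e0 : jackson (2 * L) 0 = _ := jackson_eq_autocorr (by omega)
  rw [Int.natCast_zero] at e0
  rw [← jackson_eq_autocorr hk, ← e0] at h1
  rw [autocorr_zero] at e0
  push_cast at e0 h1
  have h2 : 2 * ((L : ℝ) + 1) ^ 3 / 3 ≤ jackson (2 * L) 0 := by rw [e0]; nlinarith
  have h3 : 1 - damping (2 * L) k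
      = (jackson (2 * L) 0 - jackson (2 * L) k) / jackson (2 * L) 0 := by
    rw [damping, sub_div, div_self h0.ne']
  have h4 : (0 : ℝ) < 2 * ((L : ℝ) + 1) ^ 3 / 3 := by positivity
  rw [h3, div_le_iff₀ h0]
  have h5 : (0 : ℝ) ≤ (k : ℝ) ^ 2 * (2 * (L + 1) + k + 1) * (3 / (4 * (L + 1) ^ 3)) := by positivity
  have h6 := mul_le_mul_of_nonneg_left h2 h5
  refine le_trans ?_ h6
  have h7 : (k : ℝ) ^ 2 * (2 * (L + 1) + k + 1) * (3 / (4 * (L + 1) ^ 3)) * (2 * ((L : ℝ) + 1) ^ 3 / 3)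
     = (k : ℝ) ^ 2 * (2 * (L + 1) + k + 1) / 2 := by
    have : (L : ℝ) + 1 ≠ 0 := by positivity
    field_simp
    ring
  rw [h7]; linarith

lemma damping_le_one {L k : ℕ} (hk : k ≤ 2 * L) : damping (2 * L) k ≤ 1 := by
  rw [damping, div_le_one jackson_zero_pos, jackson_eq_autocorr hk,
    jackson_eq_autocorr (by omega), Int.natCast_zero]
  have h := autocorr_zero_sub_eq (L + 1) k
  have h2 := Finset.sum_nonneg (s := Finset.Icc (-(L + 1 : ℕ) - k : ℤ) (L + 1 : ℕ))
    fun j _ => sq_nonneg (tri (L + 1) j - tri (L + 1) (j + k))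
  linarith

/-! ### The Jackson kernel -/

open Polynomial.Chebyshev (measureT integral_measureT integrable_measureT)

lemma sqrt_inv_eq_weight (x : ℝ) : √(1 - x ^ 2)⁻¹ = weight x := by
  rw [weight, Real.sqrt_inv, one_div]

lemma integral_weight_mul (g : ℝ → ℝ) :
    ∫ x in Icc (-1 : ℝ) 1, weight x * g x = ∫ x, g x ∂measureT := by
  rw [integral_measureT, intervalIntegral.integral_of_le (by norm_num), integral_Icc_eq_integral_Ioc]
  simp only [sqrt_inv_eq_weight, mul_comm]

lemma integrableOn_weight_mul {g : ℝ → ℝ} (hg : Continuous g) :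
    IntegrableOn (fun x => weight x * g x) (Icc (-1 : ℝ) 1) := by
  have h := Polynomial.Chebyshev.intervalIntegrable_sqrt_one_sub_sq_inv.continuousOn_mul
    (g := g) hg.continuousOn
  rw [intervalIntegrable_iff_integrableOn_Icc_of_le (by norm_num)] at h
  simpa only [sqrt_inv_eq_weight, mul_comm] using h

lemma ae_mem_Icc_measureT : ∀ᵐ x ∂measureT, x ∈ Icc (-1 : ℝ) 1 := by
  filter_upwards [ae_restrict_mem (μ := volume.withDensity fun x : ℝ =>
    ENNReal.ofNNReal (.mk (√(1 - x ^ 2)⁻¹) (by positivity))) (measurableSet_Ioc (a := (-1 : ℝ)) (b := 1))]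
    with x hx using ⟨hx.1.le, hx.2⟩

lemma integral_one_measureT : ∫ _, (1 : ℝ) ∂measureT = Real.pi := by
  simpa using Polynomial.Chebyshev.integral_eval_T_real_measureT_zero

lemma integral_const_measureT (c : ℝ) : ∫ _, c ∂measureT = Real.pi * c := by
  have := integral_mul_const (μ := measureT) c (fun _ => (1 : ℝ))
  rw [integral_one_measureT] at this
  simpa using this

@[fun_prop]
lemma continuous_cheb (k : ℕ) : Continuous (cheb k) := by unfold cheb; fun_prop

/-- The squared norm `⟨T_k, w T_k⟩`. -/
def chebNorm (k : ℕ) : ℝ := if k = 0 then Real.pi else Real.pi / 2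

lemma chebNorm_pos (k : ℕ) : 0 < chebNorm k := by
  unfold chebNorm; split_ifs <;> positivity

lemma integral_cheb_mul_cheb (k l : ℕ) :
    ∫ x, cheb k x * cheb l x ∂measureT = if k = l then chebNorm k else 0 := by
  split_ifs with h
  · subst h
    unfold chebNorm cheb
    split_ifs with h
    · subst h; exact Polynomial.Chebyshev.integral_eval_T_real_mul_self_measureT_zero
    · exact Polynomial.Chebyshev.integral_T_real_mul_self_measureT_of_ne_zero h
  · exact Polynomial.Chebyshev.integral_eval_T_real_mul_eval_T_real_measureT_of_ne h

lemma chebBar_eq (k : ℕ) (x : ℝ) : chebBar k x = cheb k x / √(chebNorm k) := by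
  have h := integral_cheb_mul_cheb k k
  rw [if_pos rfl, integral_measureT] at h
  rw [chebBar, ← h]
  simp only [sqrt_inv_eq_weight]
  congr 3
  ext y; ring

@[fun_prop]
lemma continuous_chebBar (k : ℕ) : Continuous (chebBar k) := by
  simp only [funext (chebBar_eq k)]; fun_prop

lemma chebBar_mul_chebBar (k : ℕ) (x y : ℝ) :
    chebBar k x * chebBar k y = cheb k x * cheb k y / chebNorm k := by
  rw [chebBar_eq, chebBar_eq, div_mul_div_comm, Real.mul_self_sqrt (chebNorm_pos k).le]

lemma cheb_zero (x : ℝ) : cheb 0 x = 1 := by simp [cheb]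
lemma cheb_one (x : ℝ) : cheb 1 x = x := by simp [cheb]
lemma cheb_two (x : ℝ) : cheb 2 x = 2 * x ^ 2 - 1 := by simp [cheb, Polynomial.Chebyshev.T_two]

lemma cheb_cos (k : ℕ) (t : ℝ) : cheb k (Real.cos t) = Real.cos (k * t) := by
  simp [cheb, Polynomial.Chebyshev.T_real_cos]

lemma abs_cheb_le_one (k : ℕ) {x : ℝ} (hx : x ∈ Icc (-1 : ℝ) 1) : |cheb k x| ≤ 1 :=
  Polynomial.Chebyshev.abs_eval_T_real_le_one _ (abs_le.2 hx)

lemma chebBar_zero (x : ℝ) : chebBar 0 x = 1 / √Real.pi := by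
  rw [chebBar_eq, cheb_zero, chebNorm, if_pos rfl]

lemma chebBar_of_pos {k : ℕ} (hk : 0 < k) (x : ℝ) :
    chebBar k x = √(2 / Real.pi) * cheb k x := by
  rw [chebBar_eq, chebNorm, if_neg hk.ne', ← inv_div Real.pi 2, Real.sqrt_inv]
  ring

lemma integral_chebBar_of_pos {k : ℕ} (hk : 0 < k) : ∫ x, chebBar k x ∂measureT = 0 := by
  have h := integral_cheb_mul_cheb k 0
  rw [if_neg hk.ne'] at h
  simp only [cheb_zero, mul_one] at h
  simp only [chebBar_of_pos hk, integral_const_mul, h, mul_zero]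

/-- The Jackson kernel. -/
def kern (N : ℕ) (x y : ℝ) : ℝ :=
  ∑ k ∈ Finset.range (N + 1), damping N k * (chebBar k x * chebBar k y)

@[fun_prop]
lemma continuous_kern (N : ℕ) (y : ℝ) : Continuous fun x => kern N x y := by
  unfold kern; fun_prop

lemma kern_eq (N : ℕ) (x y : ℝ) : kern N x y =
    ∑ k ∈ Finset.range (N + 1), damping N k * (cheb k x * cheb k y / chebNorm k) := by
  simp only [kern, chebBar_mul_chebBar]

/-- With x = cos s and y = cos t, the product cos(ks) cos(kt) is the mean of cos(k(s - t)) and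
cos(k(s + t)). The kernel is therefore a positive multiple of the sum of the squared Fejér kernels
at s - t and s + t. -/
lemma kern_nonneg {L : ℕ} {x y : ℝ} (hx : x ∈ Icc (-1 : ℝ) 1) (hy : y ∈ Icc (-1 : ℝ) 1) :
    0 ≤ kern (2 * L) x y := by
  rw [← Real.cos_arccos hx.1 hx.2, ← Real.cos_arccos hy.1 hy.2]
  set s := Real.arccos x
  set t := Real.arccos y
  have h : kern (2 * L) (Real.cos s) (Real.cos t) * (2 * Real.pi * jackson (2 * L) 0)
      = fejer (L + 1) (s - t) ^ 2 + fejer (L + 1) (s + t) ^ 2 := by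
    have hp := Real.pi_pos.ne'
    have hj := (@jackson_zero_pos L).ne'
    rw [kern_eq, Finset.sum_range_succ', fejer_sq, fejer_sq, damping_zero, add_mul, Finset.sum_mul]
    have e0 : 1 * (cheb 0 (Real.cos s) * cheb 0 (Real.cos t) / chebNorm 0) *
        (2 * Real.pi * jackson (2 * L) 0) = 2 * autocorr (L + 1) 0 := by
      rw [cheb_zero, cheb_zero, chebNorm, if_pos rfl, jackson_eq_autocorr (by omega),
        Int.natCast_zero]
      field_simp
    rw [e0, add_add_add_comm, ← mul_add, ← Finset.sum_add_distrib, add_comm, Finset.mul_sum]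
    congr 1
    · ring
    · refine Finset.sum_congr rfl fun i hi => ?_
      rw [Finset.mem_range] at hi
      rw [cheb_cos, cheb_cos, chebNorm, if_neg i.succ_ne_zero, damping, mul_sub,
        mul_add (_ : ℝ) s t, Real.cos_sub, Real.cos_add, ← jackson_eq_autocorr (by omega)]
      field_simp
      ring
  have h0 : 0 < 2 * Real.pi * jackson (2 * L) 0 := by
    have := @jackson_zero_pos L
    positivity
  refine nonneg_of_mul_nonneg_left ?_ h0
  rw [h]; positivity

/-- By orthogonality, Chebyshev polynomials are eigenfunctions of the kernel, with the damping
factors as eigenvalues. -/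
lemma integral_kern_mul_cheb {N l : ℕ} (hl : l ≤ N) (y : ℝ) :
    ∫ x, kern N x y * cheb l x ∂measureT = damping N l * cheb l y := by
  simp only [kern_eq, Finset.sum_mul]
  rw [integral_finsetSum _ fun k _ => integrable_measureT (by fun_prop)]
  have h : ∀ k ∈ Finset.range (N + 1),
      ∫ x, damping N k * (cheb k x * cheb k y / chebNorm k) * cheb l x ∂measureT
        = if k = l then damping N l * cheb l y else 0 := by
    intro k _
    have : ∀ x, damping N k * (cheb k x * cheb k y / chebNorm k) * cheb l x
        = (damping N k * cheb k y / chebNorm k) * (cheb k x * cheb l x) := fun x => by ring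
    simp only [this, integral_const_mul, integral_cheb_mul_cheb]
    split_ifs with h
    · subst h
      field_simp [(chebNorm_pos k).ne']
    · simp
  rw [Finset.sum_congr rfl h, Finset.sum_ite_eq' _ l, if_pos (by simp; omega)]

lemma integral_kern {L : ℕ} (y : ℝ) : ∫ x, kern (2 * L) x y ∂measureT = 1 := by
  simpa [cheb_zero, damping_zero] using integral_kern_mul_cheb (Nat.zero_le (2 * L)) y

/-- Expanding (x - y)² in T_0, T_1, T_2 gives 2y²(1 - d₁) + (1/2 - y²)(1 - d₂) with d_k the damping
factors, and both deficits are O(1/L²). -/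
lemma integral_kern_mul_sq_le {L : ℕ} (hL : 0 < L) {y : ℝ} (hy : y ∈ Icc (-1 : ℝ) 1) :
    ∫ x, kern (2 * L) x y * (x - y) ^ 2 ∂measureT ≤ 14 / (L : ℝ) ^ 2 := by
  have h1 := integral_kern_mul_cheb (N := 2 * L) (l := 1) (by omega) y
  have h2 := integral_kern_mul_cheb (N := 2 * L) (l := 2) (by omega) y
  have h0 := @integral_kern L y
  rw [cheb_one] at h1
  rw [cheb_two] at h2
  have e : ∀ x, kern (2 * L) x y * (x - y) ^ 2 = (1 / 2 : ℝ) * (kern (2 * L) x y * cheb 2 x)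
      - 2 * y * (kern (2 * L) x y * cheb 1 x) + (1 / 2 + y ^ 2) * kern (2 * L) x y := by
    intro x; rw [cheb_one, cheb_two]; ring
  simp only [e]
  rw [integral_add (integrable_measureT (by fun_prop)) (integrable_measureT (by fun_prop)),
    integral_sub (integrable_measureT (by fun_prop)) (integrable_measureT (by fun_prop)),
    integral_const_mul, integral_const_mul, integral_const_mul, h0, h1, h2]
  have d1 := one_sub_damping_le (L := L) (k := 1) (by omega)
  have d2 := one_sub_damping_le (L := L) (k := 2) (by omega)
  have d2' := damping_le_one (L := L) (k := 2) (by omega)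
  have d1' := damping_le_one (L := L) (k := 1) (by omega)
  have hy2 : y ^ 2 ≤ 1 := by nlinarith [hy.1, hy.2]
  have hy0 := sq_nonneg y
  have hL' : (0 : ℝ) < L := by exact_mod_cast hL
  have b : (2 : ℝ) * (1 - damping (2 * L) 1) + (1 - damping (2 * L) 2) / 2 ≤ 14 / (L : ℝ) ^ 2 := by
    have : 3 * (8 * (L : ℝ) + 18) / (4 * (L + 1) ^ 3) ≤ 14 / (L : ℝ) ^ 2 := by
      rw [div_le_div_iff₀ (by positivity) (by positivity)]
      nlinarith [pow_pos hL' 3, pow_pos hL' 2]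
    refine le_trans ?_ this
    push_cast at d1 d2
    have e1 : 3 * (8 * (L : ℝ) + 18) / (4 * (L + 1) ^ 3)
       = 2 * (1 ^ 2 * (2 * ((L : ℝ) + 1) + 1 + 1) * (3 / (4 * (L + 1) ^ 3))) +
       (2 ^ 2 * (2 * ((L : ℝ) + 1) + 2 + 1) * (3 / (4 * (L + 1) ^ 3))) / 2 := by ring
    rw [e1]
    linarith
  nlinarith

/-- Jackson's theorem for Lipschitz functions: convolution with the Jackson kernel moves a
1-Lipschitz function by at most `5 / L`, where `2 * L` is the degree. -/
lemma abs_integral_kern_sub_le {L : ℕ} (hL : 0 < L) {y : ℝ} (hy : y ∈ Icc (-1 : ℝ) 1)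
    {f : ℝ → ℝ} (hf : LipschitzWith 1 f) :
    |∫ x, kern (2 * L) x y * f x ∂measureT - f y| ≤ 5 / L := by
  have hc := hf.continuous
  have hL' : (0 : ℝ) < L := by exact_mod_cast hL
  have e1 : ∫ x, kern (2 * L) x y * f x ∂measureT - f y
      = ∫ x, kern (2 * L) x y * (f x - f y) ∂measureT := by
    simp only [mul_sub]
    rw [integral_sub (integrable_measureT (by fun_prop)) (integrable_measureT (by fun_prop)),
      integral_mul_const, integral_kern, one_mul]
  rw [e1]
  calc _ ≤ ∫ x, |kern (2 * L) x y * (f x - f y)| ∂measureT := abs_integral_le_integral_abs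
    _ ≤ ∫ x, (2 / L * kern (2 * L) x y + L / 8 * (kern (2 * L) x y * (x - y) ^ 2)) ∂measureT := by
      refine integral_mono_ae (integrable_measureT (by fun_prop)) (integrable_measureT (by fun_prop)) ?_
      filter_upwards [ae_mem_Icc_measureT] with x hx
      have hk := kern_nonneg (L := L) hx hy
      have hd : |f x - f y| ≤ |x - y| := by
        simpa [Real.dist_eq] using hf.dist_le_mul x y
      -- Weighted arithmetic-geometric mean at scale 1/L, so that mass and second moment both
      -- contribute O(1/L).
      have ham : |x - y| ≤ 2 / L + L / 8 * (x - y) ^ 2 := by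
        have : 2 / (L : ℝ) + L / 8 * (x - y) ^ 2 - |x - y| = (L * |x - y| - 4) ^ 2 / (8 * L) := by
          rw [← sq_abs (x - y)]
          field_simp; ring
        have h2 : 0 ≤ (L * |x - y| - 4) ^ 2 / (8 * L) := by positivity
        linarith
      rw [abs_mul, abs_of_nonneg hk]
      calc _ ≤ kern (2 * L) x y * (2 / L + L / 8 * (x - y) ^ 2) := by gcongr; linarith
        _ = _ := by ring
    _ = 2 / L + L / 8 * ∫ x, kern (2 * L) x y * (x - y) ^ 2 ∂measureT := by
      rw [integral_add (integrable_measureT (by fun_prop)) (integrable_measureT (by fun_prop)),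
        integral_const_mul, integral_const_mul, integral_kern, mul_one]
    _ ≤ 2 / L + L / 8 * (14 / (L : ℝ) ^ 2) := by
      gcongr; exact integral_kern_mul_sq_le hL hy
    _ ≤ 5 / L := by
      have : 2 / (L : ℝ) + L / 8 * (14 / (L : ℝ) ^ 2) = (15 / 4) / L := by field_simp; norm_num
      rw [this]; gcongr; norm_num

/-! ### Robustness of the returned density -/

/-- The returned function as a Jackson kernel average plus an error and the positive shift. -/
lemma outputDensity_eq {ι : Type*} [Fintype ι] {N : ℕ} {p xs : ι → ℝ} {e a : ℕ → ℝ}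
    (ha : ∀ k ≤ N, a k = damping N k * (∑ i, p i * chebBar k (xs i) + e k)) (x : ℝ) :
    outputDensity N a x = weight x * ((∑ i, p i * kern N x (xs i)
      + ((∑ k ∈ Finset.range (N + 1), damping N k * e k * chebBar k x) + √2 / (N * √Real.pi)))
        / (1 + √(2 * Real.pi) / N)) := by
  have h : ∑ k ∈ Finset.range (N + 1), a k * chebBar k x = ∑ i, p i * kern N x (xs i)
      + ∑ k ∈ Finset.range (N + 1), damping N k * e k * chebBar k x := by
    simp only [kern, Finset.mul_sum]
    rw [Finset.sum_comm, ← Finset.sum_add_distrib]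
    refine Finset.sum_congr rfl fun k hk => ?_
    rw [Finset.mem_range] at hk
    rw [ha k (by omega), mul_add, add_mul, Finset.mul_sum, Finset.sum_mul]
    congr 1
    exact Finset.sum_congr rfl fun i _ => by ring
  rw [outputDensity, h]
  ring

/-- There are N terms of size at most √(2/π)/N²; their total is exactly the shift added in
`outputDensity`. This is why moments are wanted within 1/N². -/
lemma abs_sum_error_le {L : ℕ} (hL : 0 < L) {e : ℕ → ℝ} (he0 : e 0 = 0)
    (he : ∀ k, 1 ≤ k → k ≤ 2 * L → |e k| ≤ 1 / ((2 * L : ℕ) : ℝ) ^ 2) {x : ℝ}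
    (hx : x ∈ Icc (-1 : ℝ) 1) :
    |∑ k ∈ Finset.range (2 * L + 1), damping (2 * L) k * e k * chebBar k x|
      ≤ √2 / ((2 * L : ℕ) * √Real.pi) := by
  have hN : (0 : ℝ) < (2 * L : ℕ) := by exact_mod_cast (by omega : 0 < 2 * L)
  rw [Finset.sum_range_succ', he0, mul_zero, zero_mul, add_zero]
  calc _ ≤ ∑ k ∈ Finset.range (2 * L),
        |damping (2 * L) (k + 1) * e (k + 1) * chebBar (k + 1) x| := Finset.abs_sum_le_sum_abs _ _
    _ ≤ ∑ k ∈ Finset.range (2 * L), 1 * (1 / ((2 * L : ℕ) : ℝ) ^ 2) * (√(2 / Real.pi) * 1) := by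
      refine Finset.sum_le_sum fun k hk => ?_
      rw [Finset.mem_range] at hk
      rw [abs_mul, abs_mul, abs_of_nonneg damping_nonneg, chebBar_of_pos k.succ_pos, abs_mul,
        abs_of_nonneg (Real.sqrt_nonneg _)]
      gcongr
      · exact damping_le_one (by omega)
      · exact he _ (by omega) (by omega)
      · exact abs_cheb_le_one _ hx
    _ = _ := by
      rw [Finset.sum_const, Finset.card_range, nsmul_eq_mul, Real.sqrt_div (by norm_num)]
      field_simp

section Robustness

variable {ι : Type*} [Fintype ι] {L : ℕ} {p xs : ι → ℝ} {e a : ℕ → ℝ}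

/-- The kernel average is nonnegative and the shift dominates the error. The kernel has mass 1, the
error has mass 0 because `e 0 = 0`, and the shift has mass √(2π)/N, which the denominator
compensates. -/
lemma isDensity_outputDensity (hL : 0 < L) (hp : ∀ i, 0 ≤ p i) (hp1 : ∑ i, p i = 1)
    (hxs : ∀ i, xs i ∈ Icc (-1 : ℝ) 1) (he0 : e 0 = 0)
    (he : ∀ k, 1 ≤ k → k ≤ 2 * L → |e k| ≤ 1 / ((2 * L : ℕ) : ℝ) ^ 2)
    (ha : ∀ k ≤ 2 * L, a k = damping (2 * L) k * (∑ i, p i * chebBar k (xs i) + e k)) :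
    IsDensity (outputDensity (2 * L) a) := by
  have hN : (0 : ℝ) < (2 * L : ℕ) := by exact_mod_cast (by omega : 0 < 2 * L)
  have hD : 0 < 1 + √(2 * Real.pi) / (2 * L : ℕ) := by positivity
  refine ⟨fun x hx => ?_, ?_, ?_⟩
  · rw [outputDensity_eq ha]
    have h1 := (abs_le.1 (abs_sum_error_le hL he0 he hx)).1
    have h2 : 0 ≤ ∑ i, p i * kern (2 * L) x (xs i) :=
      Finset.sum_nonneg fun i _ => mul_nonneg (hp i) (kern_nonneg hx (hxs i))
    refine mul_nonneg (by unfold weight; positivity) (div_nonneg ?_ hD.le)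
    linarith
  · simp only [funext (outputDensity_eq ha)]
    exact integrableOn_weight_mul (by fun_prop)
  · simp only [outputDensity_eq ha]
    rw [integral_weight_mul, integral_div, div_eq_one_iff_eq hD.ne',
      integral_add (integrable_measureT (by fun_prop)) (integrable_measureT (by fun_prop)),
      integral_add (integrable_measureT (by fun_prop)) (integrable_measureT (by fun_prop)),
      integral_finsetSum _ fun i _ => integrable_measureT (by fun_prop),
      integral_finsetSum _ fun i _ => integrable_measureT (by fun_prop)]
    simp only [integral_const_mul, integral_kern, mul_one, hp1, integral_const_measureT]
    rw [Finset.sum_range_succ', he0, Finset.sum_eq_zero fun k _ => by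
      rw [integral_chebBar_of_pos k.succ_pos, mul_zero]]
    have hpi := Real.pi_pos
    rw [Real.sqrt_mul (by norm_num)]
    have : √Real.pi ≠ 0 := by positivity
    field_simp
    linear_combination (-√2) * Real.mul_self_sqrt hpi.le

/-- Three errors add up: smoothing (5/L), the moment error together with the shift (√(2π)/L), and
the normalization D (√(2π)/(2L)). -/
lemma abs_sub_integral_outputDensity_le (hL : 0 < L) (hp : ∀ i, 0 ≤ p i) (hp1 : ∑ i, p i = 1)
    (hxs : ∀ i, xs i ∈ Icc (-1 : ℝ) 1) (he0 : e 0 = 0)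
    (he : ∀ k, 1 ≤ k → k ≤ 2 * L → |e k| ≤ 1 / ((2 * L : ℕ) : ℝ) ^ 2)
    (ha : ∀ k ≤ 2 * L, a k = damping (2 * L) k * (∑ i, p i * chebBar k (xs i) + e k))
    {f : ℝ → ℝ} (hf : LipschitzWith 1 f) :
    |∑ i, p i * f (xs i) - ∫ x in Icc (-1 : ℝ) 1, outputDensity (2 * L) a x * f x| ≤ 9 / L := by
  have hN : (0 : ℝ) < (2 * L : ℕ) := by exact_mod_cast (by omega : 0 < 2 * L)
  have hL' : (0 : ℝ) < L := by exact_mod_cast hL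
  have hpi := Real.pi_pos
  have hD : 0 < 1 + √(2 * Real.pi) / (2 * L : ℕ) := by positivity
  have hd := isDensity_outputDensity hL hp hp1 hxs he0 he ha
  set D := 1 + √(2 * Real.pi) / (2 * L : ℕ) with hDdef
  set R : ℝ → ℝ := fun x => (∑ k ∈ Finset.range (2 * L + 1), damping (2 * L) k * e k * chebBar k x)
    + √2 / ((2 * L : ℕ) * √Real.pi) with hR
  have hRc : Continuous R := by fun_prop
  -- Both sides have mass one, so f may be centred; then |g| ≤ 1 on [-1, 1].
  set g : ℝ → ℝ := fun x => f x - f 0 with hg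
  have hgl : LipschitzWith 1 g := by
    refine LipschitzWith.of_dist_le_mul fun x y => ?_
    simpa [hg, Real.dist_eq] using hf.dist_le_mul x y
  have hgc := hgl.continuous
  have hg1 : ∀ x ∈ Icc (-1 : ℝ) 1, |g x| ≤ 1 := by
    intro x hx
    have := hf.dist_le_mul x 0
    simp only [Real.dist_eq, NNReal.coe_one, one_mul, sub_zero] at this
    exact this.trans (abs_le.2 hx)
  have hfg : ∑ i, p i * f (xs i) - ∫ x in Icc (-1 : ℝ) 1, outputDensity (2 * L) a x * f x
      = ∑ i, p i * g (xs i) - ∫ x in Icc (-1 : ℝ) 1, outputDensity (2 * L) a x * g x := by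
    have hint : ∀ h : ℝ → ℝ, Continuous h →
        IntegrableOn (fun x => outputDensity (2 * L) a x * h x) (Icc (-1 : ℝ) 1) := by
      intro h hh
      exact hd.integrable.mul_continuousOn hh.continuousOn isCompact_Icc
    simp only [hg, mul_sub, Finset.sum_sub_distrib]
    rw [integral_sub (hint _ hf.continuous) (hint _ continuous_const), integral_mul_const,
      hd.integral_eq_one, ← Finset.sum_mul, hp1]
    ring
  have hq : ∫ x in Icc (-1 : ℝ) 1, outputDensity (2 * L) a x * g x
      = (∑ i, p i * ∫ x, kern (2 * L) x (xs i) * g x ∂measureT + ∫ x, R x * g x ∂measureT) / D := by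
    simp only [outputDensity_eq ha, mul_assoc (weight _)]
    rw [integral_weight_mul, eq_div_iff hD.ne', ← integral_mul_const]
    have : ∀ x, ((∑ i, p i * kern (2 * L) x (xs i) + R x) / D) * g x * D
        = ∑ i, p i * (kern (2 * L) x (xs i) * g x) + R x * g x := by
      intro x
      rw [mul_right_comm, div_mul_cancel₀ _ hD.ne', add_mul, Finset.sum_mul]
      simp only [mul_assoc]
    have h2 := integral_congr_ae (μ := measureT) (Filter.Eventually.of_forall this)
    refine h2.trans ?_
    rw [integral_add (integrable_measureT (by fun_prop)) (integrable_measureT (by fun_prop)),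
      integral_finsetSum _ fun i _ => integrable_measureT (by fun_prop)]
    simp only [integral_const_mul]
  have hA : |∑ i, p i * ∫ x, kern (2 * L) x (xs i) * g x ∂measureT - ∑ i, p i * g (xs i)|
      ≤ 5 / L := by
    rw [← Finset.sum_sub_distrib]
    calc _ ≤ ∑ i, |p i * ∫ x, kern (2 * L) x (xs i) * g x ∂measureT - p i * g (xs i)| :=
          Finset.abs_sum_le_sum_abs _ _
      _ ≤ ∑ i, p i * (5 / L) := by
          refine Finset.sum_le_sum fun i _ => ?_
          rw [← mul_sub, abs_mul, abs_of_nonneg (hp i)]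
          exact mul_le_mul_of_nonneg_left (abs_integral_kern_sub_le hL (hxs i) hgl) (hp i)
      _ = 5 / L := by rw [← Finset.sum_mul, hp1, one_mul]
  have hB : |∫ x, R x * g x ∂measureT| ≤ √(2 * Real.pi) / L := by
    calc _ ≤ ∫ x, |R x * g x| ∂measureT := abs_integral_le_integral_abs
      _ ≤ ∫ _, 2 * (√2 / ((2 * L : ℕ) * √Real.pi)) ∂measureT := by
        refine integral_mono_ae (integrable_measureT (by fun_prop))
          (integrable_measureT (by fun_prop)) ?_
        filter_upwards [ae_mem_Icc_measureT] with x hx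
        have h1 := abs_sum_error_le hL he0 he hx
        have h2 : |R x| ≤ 2 * (√2 / ((2 * L : ℕ) * √Real.pi)) := by
          refine (abs_add_le _ _).trans ?_
          rw [abs_of_nonneg (by positivity : 0 ≤ √2 / ((2 * L : ℕ) * √Real.pi))]
          linarith
        rw [abs_mul]
        calc _ ≤ |R x| * 1 := by gcongr; exact hg1 x hx
          _ ≤ _ := by rwa [mul_one]
      _ = _ := by
        rw [integral_const_measureT, Real.sqrt_mul (by norm_num)]
        have : √Real.pi ≠ 0 := by positivity
        push_cast
        field_simp
        rw [Real.sq_sqrt hpi.le]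
  have hG : |∑ i, p i * g (xs i)| ≤ 1 := by
    calc _ ≤ ∑ i, |p i * g (xs i)| := Finset.abs_sum_le_sum_abs _ _
      _ ≤ ∑ i, p i := by
        refine Finset.sum_le_sum fun i _ => ?_
        rw [abs_mul, abs_of_nonneg (hp i)]
        exact mul_le_of_le_one_right (hp i) (hg1 _ (hxs i))
      _ = 1 := hp1
  -- Enough for 5 + (3/2) · 2.6 = 8.9 ≤ 9.
  have hs : √(2 * Real.pi) ≤ 2.6 := by
    rw [Real.sqrt_le_left (by norm_num)]
    nlinarith [Real.pi_lt_d2]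
  have hs0 := Real.sqrt_nonneg (2 * Real.pi)
  rw [hfg, hq]
  set G := ∑ i, p i * g (xs i)
  set A := ∑ i, p i * ∫ x, kern (2 * L) x (xs i) * g x ∂measureT
  set B := ∫ x, R x * g x ∂measureT
  have e1 : G - (A + B) / D = ((D - 1) * G - (A - G) - B) / D := by
    field_simp; ring
  have hD1 : D - 1 = √(2 * Real.pi) / 2 / L := by
    rw [hDdef]; push_cast; field_simp; ring
  rw [e1, abs_div, abs_of_pos hD]
  have hDge : 1 ≤ D := by
    have : 0 ≤ √(2 * Real.pi) / 2 / L := by positivity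
    linarith
  refine (div_le_self (abs_nonneg _) hDge).trans ?_
  have hDG : |(D - 1) * G| ≤ √(2 * Real.pi) / 2 / L := by
    rw [abs_mul, hD1, abs_of_nonneg (by positivity : 0 ≤ √(2 * Real.pi) / 2 / L)]
    exact mul_le_of_le_one_right (by positivity) hG
  have h3 : |(D - 1) * G - (A - G) - B| ≤ √(2 * Real.pi) / 2 / L + 5 / L + √(2 * Real.pi) / L :=
    (abs_sub _ _).trans (add_le_add ((abs_sub _ _).trans (add_le_add hDG hA)) hB)
  refine h3.trans ?_
  rw [← add_div, ← add_div]
  gcongr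
  linarith

end Robustness

/-! ### Concentration of Hutchinson's estimator -/

open ProbabilityTheory

lemma lintegral_pi_prod {α : Type*} [Fintype α] {μ : Measure ℝ} [IsProbabilityMeasure μ]
    {F : α → ℝ → ENNReal} (hF : ∀ a, Measurable (F a)) :
    ∫⁻ h : α → ℝ, ∏ a, F a (h a) ∂(Measure.pi fun _ => μ) = ∏ a, ∫⁻ x, F a x ∂μ := by
  rw [lintegral_prod_eq_prod_lintegral_of_indepFun Finset.univ
    (fun a (h : α → ℝ) => F a (h a))
    (iIndepFun_pi (μ := fun _ : α => μ) fun a => (hF a).aemeasurable) (by fun_prop)]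
  refine Finset.prod_congr rfl fun a _ => ?_
  exact (measurePreserving_eval (fun _ : α => μ) a).lintegral_comp (hF a)

lemma lintegral_exp_mul_gaussianReal (t : ℝ) :
    ∫⁻ x, ENNReal.ofReal (Real.exp (t * x)) ∂(gaussianReal 0 1)
      = ENNReal.ofReal (Real.exp (t ^ 2 / 2)) := by
  rw [← ofReal_integral_eq_lintegral_ofReal (integrable_exp_mul_gaussianReal t)
    (Filter.Eventually.of_forall fun _ => (Real.exp_pos _).le)]
  have := congrFun (mgf_fun_id_gaussianReal (μ := 0) (v := 1)) t
  rw [mgf] at this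
  rw [this]
  simp

lemma lintegral_exp_mul_sq_gaussianReal {c : ℝ} (hc : c < 1 / 2) :
    ∫⁻ x, ENNReal.ofReal (Real.exp (c * x ^ 2)) ∂(gaussianReal 0 1)
      = ENNReal.ofReal (√(1 - 2 * c))⁻¹ := by
  have h1 : ∀ x : ℝ, gaussianPDFReal 0 1 x * Real.exp (c * x ^ 2)
      = (√(2 * Real.pi))⁻¹ * Real.exp (-(1 / 2 - c) * x ^ 2) := by
    intro x
    rw [gaussianPDFReal_def]
    simp only [NNReal.coe_one, mul_one, sub_zero]
    rw [mul_assoc, ← Real.exp_add]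
    congr 2; ring
  rw [gaussianReal_of_var_ne_zero _ one_ne_zero, lintegral_withDensity_eq_lintegral_mul _
    (measurable_gaussianPDF 0 1) (by fun_prop)]
  simp only [Pi.mul_apply, gaussianPDF_def]
  have h2 : ∀ x : ℝ, ENNReal.ofReal (gaussianPDFReal 0 1 x) * ENNReal.ofReal (Real.exp (c * x ^ 2))
      = ENNReal.ofReal ((√(2 * Real.pi))⁻¹ * Real.exp (-(1 / 2 - c) * x ^ 2)) := by
    intro x
    rw [← ENNReal.ofReal_mul (gaussianPDFReal_nonneg _ _ _), h1]
  simp only [h2]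
  rw [← ofReal_integral_eq_lintegral_ofReal
    ((integrable_exp_neg_mul_sq (by linarith)).const_mul _)
    (Filter.Eventually.of_forall fun _ => by positivity), integral_const_mul, integral_gaussian]
  congr 1
  rw [← Real.sqrt_inv, ← Real.sqrt_inv, ← Real.sqrt_mul (by positivity)]
  congr 1
  have : 1 - 2 * c ≠ 0 := by linarith
  have : 1 / 2 - c ≠ 0 := by intro h; apply this; linarith
  have hpi := Real.pi_pos.ne'
  field_simp

/-- First-order expansion of -log(1 - 2c)/2. The linear term c cancels against the mean in the
Chernoff bound, and the remainder is quadratic because 1 - 2c ≥ 1/2. -/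
lemma inv_sqrt_one_sub_le {c : ℝ} (h0 : 0 ≤ c) (h1 : c ≤ 1 / 4) :
    (√(1 - 2 * c))⁻¹ ≤ Real.exp (c + 4 * c ^ 2) := by
  have hx : |2 * c| < 1 := by rw [abs_lt]; constructor <;> linarith
  have h := Real.abs_log_sub_add_sum_range_le hx 1
  have hpos : 0 < 1 - 2 * c := by linarith
  simp only [Finset.sum_range_one, abs_of_nonneg (by linarith : 0 ≤ 2 * c)] at h
  norm_num at h
  have h2 : (2 * c) ^ 2 / (1 - 2 * c) ≤ 8 * c ^ 2 := by
    rw [div_le_iff₀ hpos]; nlinarith [sq_nonneg c]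
  have h3 := (abs_le.1 h).1
  rw [← Real.sqrt_inv, Real.sqrt_le_left (Real.exp_pos _).le, ← Real.exp_nat_mul,
    ← Real.log_le_iff_le_exp (by positivity), Real.log_inv]
  push_cast
  linarith

/-! ### Quadratic forms in a jointly subgaussian vector. -/

section Chaos

variable {Ω α : Type*} [MeasurableSpace Ω] [Fintype α] {P : Measure Ω} [IsProbabilityMeasure P]
  {Y : α → Ω → ℝ}

/-- Comparison of a squared subgaussian vector with a squared Gaussian vector. -/
lemma lintegral_exp_sum_mul_sq_le (hY : ∀ a, Measurable (Y a))
    (hsub : ∀ h : α → ℝ, ∫⁻ ω, ENNReal.ofReal (Real.exp (∑ a, h a * Y a ω)) ∂P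
      ≤ ENNReal.ofReal (Real.exp ((∑ a, h a ^ 2) / 2)))
    {c : α → ℝ} (h0 : ∀ a, 0 ≤ c a) (h1 : ∀ a, c a ≤ 1 / 4) :
    ∫⁻ ω, ENNReal.ofReal (Real.exp (∑ a, c a * Y a ω ^ 2)) ∂P
      ≤ ENNReal.ofReal (Real.exp (∑ a, (c a + 4 * c a ^ 2))) := by
  have hprod : ∀ g : α → ℝ, ENNReal.ofReal (Real.exp (∑ a, g a))
      = ∏ a, ENNReal.ofReal (Real.exp (g a)) := by
    intro g
    rw [Real.exp_sum, ENNReal.ofReal_prod_of_nonneg fun _ _ => (Real.exp_pos _).le]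
  have hsq : ∀ a, √(2 * c a) ^ 2 = 2 * c a := fun a => Real.sq_sqrt (by linarith [h0 a])
  -- Write exp(c y²) as the expectation of exp(√(2c) y h) over a standard Gaussian h. After Tonelli,
  -- the integral over ω is a linear exponential moment, to which `hsub` applies; what remains is a
  -- Gaussian integral.
  calc ∫⁻ ω, ENNReal.ofReal (Real.exp (∑ a, c a * Y a ω ^ 2)) ∂P
      = ∫⁻ ω, ∫⁻ h : α → ℝ, ∏ a, ENNReal.ofReal (Real.exp (√(2 * c a) * Y a ω * h a))
          ∂(Measure.pi fun _ => gaussianReal 0 1) ∂P := by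
        refine lintegral_congr fun ω => ?_
        rw [lintegral_pi_prod (F := fun a x => ENNReal.ofReal (Real.exp (√(2 * c a) * Y a ω * x)))
          (by fun_prop), hprod]
        refine Finset.prod_congr rfl fun a _ => ?_
        rw [lintegral_exp_mul_gaussianReal, mul_pow, hsq]
        congr 2; ring
    _ = ∫⁻ h : α → ℝ, ∫⁻ ω, ∏ a, ENNReal.ofReal (Real.exp (√(2 * c a) * Y a ω * h a))
          ∂P ∂(Measure.pi fun _ => gaussianReal 0 1) := by
        refine lintegral_lintegral_swap (Measurable.aemeasurable ?_)
        refine Finset.measurable_fun_prod _ fun a _ => ?_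
        exact ENNReal.measurable_ofReal.comp (Real.measurable_exp.comp
          ((((hY a).comp measurable_fst).const_mul _).mul ((measurable_pi_apply a).comp measurable_snd)))
    _ ≤ ∫⁻ h : α → ℝ, ∏ a, ENNReal.ofReal (Real.exp (c a * h a ^ 2))
          ∂(Measure.pi fun _ => gaussianReal 0 1) := by
        refine lintegral_mono fun h => ?_
        simp only [← hprod]
        refine le_trans (le_of_eq ?_) ((hsub fun a => √(2 * c a) * h a).trans (le_of_eq ?_))
        · refine lintegral_congr fun ω => ?_
          congr 3; ext a; ring
        · congr 2
          rw [Finset.sum_div]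
          refine Finset.sum_congr rfl fun a _ => ?_
          rw [mul_pow, hsq]; ring
    _ = ∏ a, ENNReal.ofReal (√(1 - 2 * c a))⁻¹ := by
        rw [lintegral_pi_prod (F := fun a x => ENNReal.ofReal (Real.exp (c a * x ^ 2)))
          (by fun_prop)]
        exact Finset.prod_congr rfl fun a _ =>
          lintegral_exp_mul_sq_gaussianReal (by linarith [h1 a])
    _ ≤ _ := by
        rw [hprod]
        exact Finset.prod_le_prod' fun a _ =>
          ENNReal.ofReal_le_ofReal (inv_sqrt_one_sub_le (h0 a) (h1 a))

/-- Upper tail of a positive semidefinite quadratic form in a subgaussian vector. -/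
lemma measure_sum_mul_sq_sub_one_gt_le (hY : ∀ a, Measurable (Y a))
    (hsub : ∀ h : α → ℝ, ∫⁻ ω, ENNReal.ofReal (Real.exp (∑ a, h a * Y a ω)) ∂P
      ≤ ENNReal.ofReal (Real.exp ((∑ a, h a ^ 2) / 2)))
    {b : α → ℝ} (h0 : ∀ a, 0 ≤ b a) (h2 : ∀ a, b a ≤ 2) {t : ℝ} (ht0 : 0 < t) (ht1 : t ≤ 1) :
    P {ω | t * Fintype.card α < ∑ a, b a * (Y a ω ^ 2 - 1)}
      ≤ ENNReal.ofReal (Real.exp (-(Fintype.card α * t ^ 2 / 64))) := by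
  set M : ℝ := (Fintype.card α : ℝ)
  -- Minimizes 16Mλ² - λtM, with value -Mt²/64; as t ≤ 1 and b ≤ 2, the condition λb ≤ 1/4 holds.
  set lam := t / 32 with hlam
  have hmgf := lintegral_exp_sum_mul_sq_le (P := P) hY hsub (c := fun a => lam * b a)
    (fun a => mul_nonneg (by positivity) (h0 a)) (fun a => by
      have := mul_le_mul_of_nonneg_left (h2 a) (by positivity : 0 ≤ lam)
      linarith)
  set S := ∑ a, b a
  have hmarkov := meas_ge_le_lintegral_div (μ := P)
    (f := fun ω => ENNReal.ofReal (Real.exp (∑ a, lam * b a * Y a ω ^ 2)))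
    (Measurable.aemeasurable (by fun_prop))
    (ε := ENNReal.ofReal (Real.exp (lam * (t * M + S))))
    (by simp [Real.exp_pos]) ENNReal.ofReal_ne_top
  have hsum : ∀ ω, ∑ a, b a * (Y a ω ^ 2 - 1) = ∑ a, b a * Y a ω ^ 2 - S := by
    intro ω; simp only [mul_sub, mul_one, Finset.sum_sub_distrib, S]
  refine (measure_mono fun ω hω => ?_).trans (hmarkov.trans ?_)
  · simp only [mem_ofPred_eq, hsum] at hω ⊢
    refine ENNReal.ofReal_le_ofReal (Real.exp_le_exp.2 ?_)
    simp only [mul_assoc, ← Finset.mul_sum]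
    exact mul_le_mul_of_nonneg_left (by linarith) (by positivity)
  · refine (ENNReal.div_le_div_right hmgf _).trans ?_
    rw [← ENNReal.ofReal_div_of_pos (Real.exp_pos _), ← Real.exp_sub]
    refine ENNReal.ofReal_le_ofReal (Real.exp_le_exp.2 ?_)
    have hb : ∑ a, b a ^ 2 ≤ M * 4 := by
      calc _ ≤ ∑ _a : α, (4 : ℝ) := Finset.sum_le_sum fun a _ => by nlinarith [h0 a, h2 a]
        _ = _ := by simp [M]
    have e : ∑ a, (lam * b a + 4 * (lam * b a) ^ 2) = lam * S + 4 * lam ^ 2 * ∑ a, b a ^ 2 := by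
      simp only [mul_pow, Finset.sum_add_distrib, S, Finset.mul_sum, mul_assoc]
    rw [e]
    have : 4 * lam ^ 2 * ∑ a, b a ^ 2 ≤ 4 * lam ^ 2 * (M * 4) := by gcongr
    have e2 : 4 * lam ^ 2 * (M * 4) - lam * (t * M) = -(M * t ^ 2 / 64) := by rw [hlam]; ring
    linarith

end Chaos

/-- The random sign given by coin number `k`. -/
def sgn (ω : ℕ → Bool) (k : ℕ) : ℝ := if ω k then 1 else -1

instance : IsProbabilityMeasure (PMF.uniformOfFintype Bool).toMeasure :=
  PMF.toMeasure.isProbabilityMeasure _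

instance : IsProbabilityMeasure coinLaw := by unfold coinLaw; infer_instance

lemma measurable_sgn (k : ℕ) : Measurable fun ω => sgn ω k :=
  (measurable_of_countable fun b : Bool => if b then (1 : ℝ) else -1).comp (measurable_pi_apply k)

lemma sgn_sq (ω : ℕ → Bool) (k : ℕ) : sgn ω k ^ 2 = 1 := by
  unfold sgn; split_ifs <;> norm_num

lemma integral_sgn (k : ℕ) : ∫ ω, sgn ω k ∂coinLaw = 0 := by
  have h : ∫ ω, sgn ω k ∂coinLaw
      = ∫ b, (if b then (1 : ℝ) else -1) ∂(PMF.uniformOfFintype Bool).toMeasure := by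
    have := (measurePreserving_eval_infinitePi
      (fun _ : ℕ => (PMF.uniformOfFintype Bool).toMeasure) k)
    rw [← this.map_eq, integral_map (measurable_pi_apply k).aemeasurable
      (measurable_of_countable _).aestronglyMeasurable]
    rfl
  rw [h, PMF.integral_eq_sum]
  simp

lemma iIndepFun_sgn : iIndepFun (fun k ω => sgn ω k) coinLaw :=
  iIndepFun_infinitePi (P := fun _ : ℕ => (PMF.uniformOfFintype Bool).toMeasure)
    (X := fun _ b => if b then (1 : ℝ) else -1) fun _ => measurable_of_countable _

lemma hasSubgaussianMGF_sgn (k : ℕ) : HasSubgaussianMGF (fun ω => sgn ω k) 1 coinLaw := by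
  have h := hasSubgaussianMGF_of_mem_Icc_of_integral_eq_zero (μ := coinLaw) (a := -1) (b := 1)
    (measurable_sgn k).aemeasurable (Filter.Eventually.of_forall fun ω => by
      unfold sgn; split_ifs <;> norm_num) (integral_sgn k)
  have e : (‖(1 : ℝ) - -1‖₊ / 2) ^ 2 = 1 := by
    rw [show (1 : ℝ) - -1 = 2 by norm_num]; simp
  rwa [e] at h

/-- Injectivity of `k` means that distinct coins, hence independent signs, are combined; each has
subgaussian parameter 1. -/
lemma lintegral_exp_sum_mul_sgn_le {β : Type*} [Fintype β] {k : β → ℕ}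
    (hk : Function.Injective k) (w : β → ℝ) :
    ∫⁻ ω, ENNReal.ofReal (Real.exp (∑ b, w b * sgn ω (k b))) ∂coinLaw
      ≤ ENNReal.ofReal (Real.exp ((∑ b, w b ^ 2) / 2)) := by
  have hind : iIndepFun (fun b ω => w b * sgn ω (k b)) coinLaw :=
    (iIndepFun_sgn.precomp hk).comp (fun b x => w b * x) fun b => by fun_prop
  have h := HasSubgaussianMGF.sum_of_iIndepFun hind (s := Finset.univ)
    fun b _ => (hasSubgaussianMGF_sgn (k b)).const_mul (w b)
  have hi := h.integrable_exp_mul 1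
  have hm := h.mgf_le 1
  simp only [mgf, one_mul] at hi hm
  rw [← ofReal_integral_eq_lintegral_ofReal hi
    (Filter.Eventually.of_forall fun _ => (Real.exp_pos _).le)]
  refine ENNReal.ofReal_le_ofReal (hm.trans (le_of_eq ?_))
  rw [NNReal.coe_sum, one_pow, mul_one]
  congr 2
  exact Finset.sum_congr rfl fun b _ => mul_one (w b ^ 2)

/-- The sign vector of repetition `i`. -/
def signVec (n : ℕ) (ω : ℕ → Bool) (i : ℕ) : Vec n :=
  WithLp.toLp 2 fun l : Fin n => sgn ω (i * n + l)

lemma norm_sq_signVec (n : ℕ) (ω : ℕ → Bool) (i : ℕ) : ‖signVec n ω i‖ ^ 2 = n := by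
  simp [EuclideanSpace.norm_sq_eq, signVec, sgn_sq]

/-! ### Hutchinson's estimator in spectral coordinates. -/

section Hutchinson

variable {n m : ℕ} (u : OrthonormalBasis (Fin n) ℝ (Vec n))

/-- Spectral coordinates of the sign vectors. -/
def signCoord (ω : ℕ → Bool) (i : ℕ) (j : Fin n) : ℝ := inner ℝ (u j) (signVec n ω i)

/-- Parseval, valid for every outcome. It permits adding the identity to a quadratic form in the
tail bound, and makes Hutchinson's weights on the eigenvalues sum to one. -/
lemma sum_signCoord_sq (ω : ℕ → Bool) (i : ℕ) : ∑ j, signCoord u ω i j ^ 2 = n := by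
  rw [← norm_sq_signVec n ω i, ← u.sum_sq_norm_inner_right (signVec n ω i)]
  simp [signCoord]

lemma signCoord_eq_sum (ω : ℕ → Bool) (i : ℕ) (j : Fin n) :
    signCoord u ω i j = ∑ l, u j l * sgn ω (i * n + l) := by
  simp [signCoord, signVec, PiLp.inner_apply, mul_comm]

lemma measurable_signCoord (i : ℕ) (j : Fin n) : Measurable fun ω => signCoord u ω i j := by
  simp only [signCoord_eq_sum]
  exact Finset.measurable_fun_sum _ fun l _ => (measurable_sgn _).const_mul _

/-- The coordinates need not be independent, but a bound on the joint exponential moment survives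
rotation: the coefficient vector ∑ h_j u_j has squared norm ∑ h_j². -/
lemma lintegral_exp_sum_signCoord_le (h : Fin m × Fin n → ℝ) :
    ∫⁻ ω, ENNReal.ofReal (Real.exp (∑ a, h a * signCoord u ω a.1 a.2)) ∂coinLaw
      ≤ ENNReal.ofReal (Real.exp ((∑ a, h a ^ 2) / 2)) := by
  -- Repetitions use disjoint blocks of n coins.
  have hk : Function.Injective fun a : Fin m × Fin n => (a.1 : ℕ) * n + a.2 := by
    rintro ⟨i, l⟩ ⟨i', l'⟩ he
    simp only at he
    have h1 := l.2
    have h2 := l'.2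
    have e1 : (i : ℕ) = i' := by
      have := congrArg (· / n) he
      simpa [Nat.add_div_of_dvd_right, Nat.div_eq_of_lt h1, Nat.div_eq_of_lt h2,
        Nat.mul_div_cancel _ (by omega : 0 < n)] using this
    have e2 : (l : ℕ) = l' := by rw [e1] at he; omega
    exact Prod.ext (Fin.ext e1) (Fin.ext e2)
  have := lintegral_exp_sum_mul_sgn_le hk
    fun a => (∑ j, h (a.1, j) • u j : Vec n) a.2
  refine le_trans (le_of_eq ?_) (this.trans (le_of_eq ?_))
  · refine lintegral_congr fun ω => ?_
    congr 2
    rw [Fintype.sum_prod_type, Fintype.sum_prod_type]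
    refine Finset.sum_congr rfl fun i _ => ?_
    simp only [signCoord_eq_sum, Finset.mul_sum, WithLp.ofLp_sum, WithLp.ofLp_smul,
      Finset.sum_apply, Pi.smul_apply, smul_eq_mul, Finset.sum_mul]
    rw [Finset.sum_comm]
    simp only [mul_assoc]
  · congr 3
    rw [Fintype.sum_prod_type, Fintype.sum_prod_type]
    refine Finset.sum_congr rfl fun i _ => ?_
    have h1 := EuclideanSpace.norm_sq_eq (∑ j, h (i, j) • u j : Vec n)
    simp only [Real.norm_eq_abs, sq_abs] at h1
    rw [← h1, ← u.sum_sq_norm_inner_right]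
    refine Finset.sum_congr rfl fun j _ => ?_
    rw [u.orthonormal.inner_right_fintype, Real.norm_eq_abs, sq_abs]

/-- Tail bound for Hutchinson's estimator of the trace of a matrix with eigenvalues in `[-1, 1]`. -/
lemma coinLaw_hutchinson_le {x : Fin n → ℝ} (hx : ∀ j, |x j| ≤ 1) {t : ℝ} (ht0 : 0 < t)
    (ht1 : t ≤ 1) :
    coinLaw {ω | t * (m * n) < |∑ i : Fin m, ∑ j, x j * signCoord u ω i j ^ 2 - m * ∑ j, x j|}
      ≤ 2 * ENNReal.ofReal (Real.exp (-(m * n * t ^ 2 / 64))) := by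
  -- With s = ±1 for the two tails, the coefficients 1 + s x_j lie in [0, 2]. The added 1 changes
  -- nothing, since ∑_j (Y_j² - 1) = 0 in each repetition.
  have key : ∀ s : ℝ, |s| ≤ 1 →
      coinLaw {ω | t * (m * n) < s * (∑ i : Fin m, ∑ j, x j * signCoord u ω i j ^ 2 - m * ∑ j, x j)}
        ≤ ENNReal.ofReal (Real.exp (-(m * n * t ^ 2 / 64))) := by
    intro s hs
    have hb : ∀ j, |s * x j| ≤ 1 := fun j => by
      rw [abs_mul]; exact mul_le_one₀ hs (abs_nonneg _) (hx j)
    have h := measure_sum_mul_sq_sub_one_gt_le (P := coinLaw) (α := Fin m × Fin n)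
      (Y := fun a ω => signCoord u ω a.1 a.2) (fun a => measurable_signCoord u _ _)
      (lintegral_exp_sum_signCoord_le u) (b := fun a => 1 + s * x a.2)
      (fun a => by linarith [(abs_le.1 (hb a.2)).1]) (fun a => by linarith [(abs_le.1 (hb a.2)).2])
      ht0 ht1
    simp only [Fintype.card_prod, Fintype.card_fin, Nat.cast_mul] at h
    refine le_trans (le_of_eq ?_) h
    congr 1
    ext ω
    simp only [mem_ofPred_eq, Fintype.sum_prod_type]
    have e : ∑ i : Fin m, ∑ j, (1 + s * x j) * (signCoord u ω i j ^ 2 - 1)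
        = s * (∑ i : Fin m, ∑ j, x j * signCoord u ω i j ^ 2 - m * ∑ j, x j) := by
      have : ∀ i : Fin m, ∑ j, (1 + s * x j) * (signCoord u ω i j ^ 2 - 1)
          = s * (∑ j, x j * signCoord u ω i j ^ 2 - ∑ j, x j) := by
        intro i
        have h1 := sum_signCoord_sq u ω i
        have : ∀ j, (1 + s * x j) * (signCoord u ω i j ^ 2 - 1) = signCoord u ω i j ^ 2 - 1
          + s * (x j * signCoord u ω i j ^ 2 - x j) := fun j => by ring
        simp only [this, Finset.sum_add_distrib, Finset.sum_sub_distrib, h1, ← Finset.mul_sum]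
        simp
      simp only [this, ← Finset.mul_sum, Finset.sum_sub_distrib]
      simp
    rw [e]
  refine (measure_mono fun ω hω => ?_).trans ((measure_union_le _ _).trans
    ((add_le_add (key 1 (by simp)) (key (-1) (by simp))).trans (le_of_eq (two_mul _).symm)))
  simp only [mem_ofPred_eq, mem_union, one_mul, neg_one_mul] at hω ⊢
  exact lt_abs.1 hω

end Hutchinson

/-! ### Error propagation in the Chebyshev recurrence -/

section Recurrence

open Polynomial.Chebyshev in
/-- Solution of the perturbed Chebyshev recurrence. -/
lemma recurrence_eq_sum (x : ℝ) (y r : ℕ → ℝ) (h1 : y 1 = x * y 0 + r 0)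
    (h2 : ∀ k, y (k + 2) = 2 * x * y (k + 1) - y k + r (k + 1)) (k : ℕ) :
    y k = cheb k x * y 0 + ∑ i ∈ Finset.range k, (U ℝ ((k : ℤ) - 1 - i)).eval x * r i := by
  induction k using Nat.twoStepInduction with
  | zero => simp [cheb]
  | one => simp [cheb, h1]
  | more k ih1 ih2 =>
    have hT : cheb (k + 2) x = 2 * x * cheb (k + 1) x - cheb k x := by
      simp only [cheb]; push_cast; rw [T_add_two]; simp
    have hU : ∀ i : ℕ, (U ℝ (((k + 2 : ℕ) : ℤ) - 1 - i)).eval x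
        = 2 * x * (U ℝ (((k + 1 : ℕ) : ℤ) - 1 - i)).eval x - (U ℝ ((k : ℤ) - 1 - i)).eval x := by
      intro i
      rw [show (((k + 2 : ℕ) : ℤ) - 1 - i) = (k - 1 - i) + 2 by push_cast; ring, U_add_two,
        show (((k + 1 : ℕ) : ℤ) - 1 - i) = (k - 1 - i) + 1 by push_cast; ring]
      simp
    rw [h2, ih2, ih1, hT]
    simp only [hU, sub_mul, Finset.sum_sub_distrib]
    rw [Finset.sum_range_succ _ (k + 1),
      Finset.sum_range_succ (fun i : ℕ => (U ℝ ((k : ℤ) - 1 - i)).eval x * r i) (k + 1),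
      Finset.sum_range_succ (fun i : ℕ => (U ℝ ((k : ℤ) - 1 - i)).eval x * r i) k]
    simp only [mul_assoc, ← Finset.mul_sum]
    -- The boundary terms involve U_{-1} = 0 and U_{-2} = -1; the latter yields the new residual
    -- with coefficient 1.
    have e1 : ((k : ℤ) - 1 - k) = -1 := by ring
    have e2 : ((k : ℤ) - 1 - (k + 1 : ℕ)) = -2 := by push_cast; ring
    have e3 : (((k + 1 : ℕ) : ℤ) - 1 - (k + 1 : ℕ)) = -1 := by push_cast; ring
    rw [e1, e2, e3]
    simp
    ring

-- Induction on U_{k+1} = x U_k + T_{k+1}.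
open Polynomial.Chebyshev in
lemma abs_eval_U_le {x : ℝ} (hx : |x| ≤ 1) (k : ℕ) : |(U ℝ (k : ℤ)).eval x| ≤ k + 1 := by
  induction k with
  | zero => simp
  | succ k ih =>
    push_cast
    rw [U_eq_X_mul_U_add_T]
    simp only [Polynomial.eval_add, Polynomial.eval_mul, Polynomial.eval_X]
    refine (abs_add_le _ _).trans (add_le_add ?_ (abs_eval_T_real_le_one _ hx))
    rw [abs_mul]
    exact (mul_le_of_le_one_left (abs_nonneg _) hx).trans ih

variable {n : ℕ} {A : Matrix (Fin n) (Fin n) ℝ} (hA : A.IsHermitian)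

lemma mulCLM_eigenvectorBasis (j : Fin n) :
    mulCLM A (hA.eigenvectorBasis j) = hA.eigenvalues j • hA.eigenvectorBasis j := by
  ext l
  simpa using congrFun (hA.mulVec_eigenvectorBasis j) l

lemma inner_eigenvectorBasis_mulCLM (j : Fin n) (v : Vec n) :
    inner ℝ (hA.eigenvectorBasis j) (mulCLM A v)
      = hA.eigenvalues j * inner ℝ (hA.eigenvectorBasis j) v := by
  have hsym : (Matrix.toEuclideanLin A).IsSymmetric := Matrix.isSymmetric_toEuclideanLin_iff.2 hA
  have h := hsym (hA.eigenvectorBasis j) v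
  have h2 : inner ℝ (mulCLM A (hA.eigenvectorBasis j)) v
      = inner ℝ (hA.eigenvectorBasis j) (mulCLM A v) := h
  rw [← h2, mulCLM_eigenvectorBasis, inner_smul_left]
  simp

lemma abs_eigenvalues_le_one (hn : ‖mulCLM A‖ ≤ 1) (j : Fin n) : |hA.eigenvalues j| ≤ 1 := by
  have h := (mulCLM A).le_opNorm (hA.eigenvectorBasis j)
  rw [mulCLM_eigenvectorBasis, norm_smul, hA.eigenvectorBasis.orthonormal.1 j] at h
  simpa using h.trans (by simpa using hn)

/-- The operator acting diagonally in an orthonormal basis. -/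
def diagOp (u : OrthonormalBasis (Fin n) ℝ (Vec n)) (c : Fin n → ℝ) (v : Vec n) : Vec n :=
  ∑ j, (c j * inner ℝ (u j) v) • u j

lemma inner_diagOp (u : OrthonormalBasis (Fin n) ℝ (Vec n)) (c : Fin n → ℝ) (v : Vec n)
    (j : Fin n) : inner ℝ (u j) (diagOp u c v) = c j * inner ℝ (u j) v := by
  rw [diagOp, u.orthonormal.inner_right_fintype]

lemma norm_diagOp_le (u : OrthonormalBasis (Fin n) ℝ (Vec n)) {c : Fin n → ℝ} {b : ℝ}
    (hb : 0 ≤ b) (hc : ∀ j, |c j| ≤ b) (v : Vec n) : ‖diagOp u c v‖ ≤ b * ‖v‖ := by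
  refine le_of_sq_le_sq ?_ (by positivity)
  rw [mul_pow, ← u.sum_sq_norm_inner_right, ← u.sum_sq_norm_inner_right v, Finset.mul_sum]
  refine Finset.sum_le_sum fun j _ => ?_
  rw [inner_diagOp, norm_mul, mul_pow]
  gcongr
  exact hc j

/-- Stability of the forward Chebyshev recurrence with inexact products. -/
lemma norm_recurrence_sub_le (hn : ‖mulCLM A‖ ≤ 1) {N : ℕ} {η : ℝ} (hη : 0 ≤ η)
    (hηN : 4 * η * (N : ℝ) ^ 2 ≤ 1) {v : ℕ → Vec n}
    (h1 : ‖v 1 - mulCLM A (v 0)‖ ≤ η * ‖v 0‖)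
    (h2 : ∀ k, k + 2 ≤ N → ‖v (k + 2) - ((2 : ℝ) • mulCLM A (v (k + 1)) - v k)‖
      ≤ 2 * η * ‖v (k + 1)‖) {k : ℕ} (hk : k ≤ N) :
    ‖v k - diagOp hA.eigenvectorBasis (fun j => cheb k (hA.eigenvalues j)) (v 0)‖
      ≤ 4 * η * (N : ℝ) ^ 2 * ‖v 0‖ := by
  set u := hA.eigenvectorBasis
  set r : ℕ → Vec n := fun i => match i with
    | 0 => v 1 - mulCLM A (v 0)
    | i + 1 => v (i + 2) - ((2 : ℝ) • mulCLM A (v (i + 1)) - v i) with hr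
  have hx := abs_eigenvalues_le_one hA hn
  -- In each eigenvector coordinate the vectors obey the scalar perturbed recurrence.
  have hsum : ∀ k, v k - diagOp u (fun j => cheb k (hA.eigenvalues j)) (v 0)
      = ∑ i ∈ Finset.range k,
        diagOp u (fun j => (Polynomial.Chebyshev.U ℝ ((k : ℤ) - 1 - i)).eval (hA.eigenvalues j)) (r i) := by
    intro k
    refine InnerProductSpace.ext_inner_left_basis u.toBasis fun j => ?_
    rw [OrthonormalBasis.coe_toBasis, inner_sub_right, inner_sum, inner_diagOp]
    simp only [inner_diagOp]
    rw [sub_eq_iff_eq_add']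
    refine recurrence_eq_sum (hA.eigenvalues j) (fun k => inner ℝ (u j) (v k))
      (fun i => inner ℝ (u j) (r i)) ?_ (fun k => ?_) k
    · simp only [hr, inner_sub_right, inner_eigenvectorBasis_mulCLM, u]; ring
    · simp only [hr, inner_sub_right, inner_smul_right, inner_eigenvectorBasis_mulCLM, u]; ring
  -- Bootstrap: the residuals are relative to ‖v i‖, and the claim for smaller indices keeps these
  -- norms below 2‖v 0‖. At most N residuals of size 4η‖v 0‖ are then each amplified by at most N.
  induction k using Nat.strong_induction_on with
  | _ k ih =>
    have hv : ∀ i < k, ‖v i‖ ≤ 2 * ‖v 0‖ := by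
      intro i hi
      have e1 := ih i hi (by omega)
      have e2 := norm_diagOp_le u (b := 1) zero_le_one
        (fun j => abs_cheb_le_one i (abs_le.1 (hx j))) (v 0)
      have e3 := norm_le_norm_sub_add (v i) (diagOp u (fun j => cheb i (hA.eigenvalues j)) (v 0))
      have e4 : 4 * η * (N : ℝ) ^ 2 * ‖v 0‖ ≤ 1 * ‖v 0‖ := by gcongr
      linarith
    have hri : ∀ i < k, ‖r i‖ ≤ 4 * η * ‖v 0‖ := by
      intro i hi
      match i with
      | 0 =>
        refine h1.trans ?_
        have : 0 ≤ η * ‖v 0‖ := by positivity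
        linarith
      | i + 1 =>
        refine (h2 i (by omega)).trans ?_
        have := mul_le_mul_of_nonneg_left (hv (i + 1) hi) (by positivity : 0 ≤ 2 * η)
        linarith
    rw [hsum k]
    calc _ ≤ ∑ i ∈ Finset.range k, ‖diagOp u (fun j =>
          (Polynomial.Chebyshev.U ℝ ((k : ℤ) - 1 - i)).eval (hA.eigenvalues j)) (r i)‖ :=
          norm_sum_le _ _
      _ ≤ ∑ i ∈ Finset.range k, N * (4 * η * ‖v 0‖) := by
          refine Finset.sum_le_sum fun i hi => ?_
          rw [Finset.mem_range] at hi
          refine (norm_diagOp_le u (b := N) (Nat.cast_nonneg _) (fun j => ?_) _).trans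
            (mul_le_mul_of_nonneg_left (hri i hi) (Nat.cast_nonneg _))
          rw [show ((k : ℤ) - 1 - i) = ((k - 1 - i : ℕ) : ℤ) by omega]
          refine (abs_eval_U_le (hx j) _).trans ?_
          exact_mod_cast (by omega : k - 1 - i + 1 ≤ N)
      _ = k * (N * (4 * η * ‖v 0‖)) := by simp
      _ ≤ N * (N * (4 * η * ‖v 0‖)) := by gcongr
      _ = _ := by ring

/-- Accuracy of one moment computed from the perturbed recurrence. -/
lemma abs_inner_recurrence_sub_le (hn : ‖mulCLM A‖ ≤ 1) {N : ℕ} {η : ℝ} (hη : 0 ≤ η)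
    (hηN : 4 * η * (N : ℝ) ^ 2 ≤ 1) {v : ℕ → Vec n}
    (h1 : ‖v 1 - mulCLM A (v 0)‖ ≤ η * ‖v 0‖)
    (h2 : ∀ k, k + 2 ≤ N → ‖v (k + 2) - ((2 : ℝ) • mulCLM A (v (k + 1)) - v k)‖
      ≤ 2 * η * ‖v (k + 1)‖) {k : ℕ} (hk : k ≤ N) :
    |inner ℝ (v 0) (v k) - ∑ j, cheb k (hA.eigenvalues j) *
        inner ℝ (hA.eigenvectorBasis j) (v 0) ^ 2| ≤ 4 * η * (N : ℝ) ^ 2 * ‖v 0‖ ^ 2 := by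
  have h := norm_recurrence_sub_le hA hn hη hηN h1 h2 hk
  have e : ∑ j, cheb k (hA.eigenvalues j) * inner ℝ (hA.eigenvectorBasis j) (v 0) ^ 2
      = inner ℝ (v 0) (diagOp hA.eigenvectorBasis (fun j => cheb k (hA.eigenvalues j)) (v 0)) := by
    rw [diagOp, inner_sum]
    refine Finset.sum_congr rfl fun j _ => ?_
    rw [inner_smul_right, real_inner_comm (v 0) (hA.eigenvectorBasis j)]
    ring
  rw [e, ← inner_sub_right]
  refine (abs_real_inner_le_norm _ _).trans ?_
  have := mul_le_mul_of_nonneg_left h (norm_nonneg (v 0))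
  refine this.trans (le_of_eq ?_)
  ring

end Recurrence

/-! ### Semantics of the program -/

section Semantics

variable {n : ℕ} {O : Oracle n} {ω : ℕ → Bool}

/-- Execution of a program from a given configuration. -/
def execProg (O : Oracle n) (ω : ℕ → Bool) (P : Prog) (c : Config n) : Config n :=
  P.foldl (exec O ω) c

lemma execProg_append (P Q : Prog) (c : Config n) :
    execProg O ω (P ++ Q) c = execProg O ω Q (execProg O ω P c) := List.foldl_append

lemma execProg_cons (i : Instr) (P : Prog) (c : Config n) :
    execProg O ω (i :: P) c = execProg O ω P (exec O ω c i) := rfl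

/-- The loop-invariant rule by which the loops of the program are verified. -/
lemma execProg_forLoop {k : ℕ} {body : ℕ → Prog} (I : ℕ → Config n → Prop) {c : Config n}
    (h0 : I 0 c) (hs : ∀ i < k, ∀ c, I i c → I (i + 1) (execProg O ω (body i) c)) :
    I k (execProg O ω (forLoop k body) c) := by
  induction k with
  | zero => exact h0
  | succ k ih =>
    have e : forLoop (k + 1) body = forLoop k body ++ body k := by
      simp [forLoop, List.range_succ]
    rw [e, execProg_append]
    exact hs k k.lt_succ_self _ (ih fun i hi => hs i (hi.trans k.lt_succ_self))

lemma drawSigns_spec (c : Config n) :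
    (execProg O ω (drawSigns n) c).coins = c.coins + n ∧
    (execProg O ω (drawSigns n) c).vec (.v 0) = WithLp.toLp 2 (fun l : Fin n => sgn ω (c.coins + l)) ∧
    ∀ X j, X ≠ .v 0 → (execProg O ω (drawSigns n) c).mem X j = c.mem X j := by
  have h := execProg_forLoop (O := O) (ω := ω) (k := n) (body := fun j => [.coin (.v 0, j)]) (c := c)
    (fun i c' => c'.coins = c.coins + i ∧ (∀ j < i, c'.mem (.v 0) j = sgn ω (c.coins + j)) ∧
      ∀ X j, X ≠ .v 0 → c'.mem X j = c.mem X j) ⟨rfl, by simp, fun _ _ _ => rfl⟩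
    (by
      rintro i - c' ⟨h1, h2, h3⟩
      refine ⟨?_, fun j hj => ?_, fun X j hX => ?_⟩
      · simp [execProg, exec, Config.write, h1, add_assoc]
      · rcases Nat.lt_succ_iff_lt_or_eq.1 hj with hj | rfl
        · simp [execProg, exec, Config.write, hj.ne, h2 j hj]
        · simp [execProg, exec, Config.write, h1, sgn]
      · simp [execProg, exec, Config.write, hX, h3 X j hX])
  refine ⟨h.1, ?_, h.2.2⟩
  ext l
  exact h.2.1 l l.2

lemma addMoment_spec (k : ℕ) (c : Config n) :
    (execProg O ω (addMoment n k) c).coins = c.coins ∧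
    (execProg O ω (addMoment n k) c).mem .tau k
      = c.mem .tau k + inner ℝ (c.vec (.v 0)) (c.vec (.v k)) ∧
    ∀ X j, X ≠ .tmp → (X = .tau → j ≠ k) → (execProg O ω (addMoment n k) c).mem X j = c.mem X j := by
  have h := execProg_forLoop (O := O) (ω := ω) (k := n) (c := c)
    (body := fun j => [.mul (.tmp, 0) (.v 0, j) (.v k, j), .add (.tau, k) (.tau, k) (.tmp, 0)])
    (fun i c' => c'.coins = c.coins ∧ (c'.mem .tau k = c.mem .tau k +
        ∑ j ∈ Finset.range i, c.mem (.v 0) j * c.mem (.v k) j) ∧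
      ∀ X j, X ≠ .tmp → (X = .tau → j ≠ k) → c'.mem X j = c.mem X j)
    ⟨rfl, by simp, fun _ _ _ _ => rfl⟩
    (by
      rintro i - c' ⟨h1, h2, h3⟩
      refine ⟨?_, ?_, fun X j hX hj => ?_⟩
      · simp [execProg, exec, Config.write, h1]
      · simp [execProg, exec, Config.write, Config.read, h2, Finset.sum_range_succ,
          h3 (.v 0) i (by simp) (by simp), h3 (.v k) i (by simp) (by simp), add_assoc]
      · have : ¬(X = .tau ∧ j = k) := fun h => hj h.1 h.2
        simp [execProg, exec, Config.write, Config.read, this, hX, h3 X j hX hj])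
  refine ⟨h.1, ?_, h.2.2⟩
  rw [addMoment, h.2.1, Finset.sum_range]
  congr 1
  simp [PiLp.inner_apply, Config.vec, mul_comm]

/-- The history `c.past` stays explicit; `IsAMV` bounds the answer for every history, so adaptive
oracles need no extra argument. -/
lemma recurrenceStep_spec (k : ℕ) (c : Config n) :
    (execProg O ω (recurrenceStep n (k + 2)) c).coins = c.coins ∧
    (execProg O ω (recurrenceStep n (k + 2)) c).vec (.v (k + 2))
      = (2 : ℝ) • O c.past (c.vec (.v (k + 1))) - c.vec (.v k) ∧
    ∀ X j, X ≠ .tmp → X ≠ .w → X ≠ .v (k + 2) →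
      (execProg O ω (recurrenceStep n (k + 2)) c).mem X j = c.mem X j := by
  set z := O c.past (c.vec (.v (k + 1))) with hz
  have h := execProg_forLoop (O := O) (ω := ω) (k := n) (c := exec O ω c (.amv .w (.v (k + 1))))
    (body := fun j => [.lit (.tmp, 0) 2, .mul (.tmp, 0) (.tmp, 0) (.w, j),
       .sub (.v (k + 2), j) (.tmp, 0) (.v k, j)])
    (fun i c' => c'.coins = c.coins ∧
      (∀ j : Fin n, c'.mem .w j = z j) ∧
      (∀ j : Fin n, (j : ℕ) < i → c'.mem (.v (k + 2)) j = 2 * z j - c.mem (.v k) j) ∧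
      ∀ X j, X ≠ .tmp → X ≠ .w → X ≠ .v (k + 2) → c'.mem X j = c.mem X j)
    ⟨rfl, fun j => by simp [exec, Config.answer, hz], by simp, fun X j _ hX _ => by
      simp [exec, Config.answer, hX]⟩
    (by
      rintro i hi c' ⟨h1, h2, h3, h4⟩
      refine ⟨?_, fun j => ?_, fun j hj => ?_, fun X j hX hw hv => ?_⟩
      · simp [execProg, exec, Config.write, h1]
      · simp [execProg, exec, Config.write, h2]
      · rcases Nat.lt_succ_iff_lt_or_eq.1 hj with hj | hj
        · simp [execProg, exec, Config.write, hj.ne, h3 j hj]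
        · have e := h2 j
          rw [hj] at e
          simp [execProg, exec, Config.write, Config.read, hj, e,
            h4 (.v k) i (by simp) (by simp) (by simp)]
      · simp [execProg, exec, Config.write, Config.read, hX, hv, h4 X j hX hw hv])
  have e : execProg O ω (recurrenceStep n (k + 2)) c = execProg O ω (forLoop n fun j =>
      [.lit (.tmp, 0) 2, .mul (.tmp, 0) (.tmp, 0) (.w, j),
       .sub (.v (k + 2), j) (.tmp, 0) (.v k, j)]) (exec O ω c (.amv .w (.v (k + 1)))) := rfl
  rw [← e] at h
  refine ⟨h.1, ?_, h.2.2.2⟩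
  ext l
  simpa [Config.vec] using h.2.2.1 l l.2

lemma Config.vec_congr {c c' : Config n} {X : Arr} (h : ∀ j, c'.mem X j = c.mem X j) :
    c'.vec X = c.vec X := by
  simp [Config.vec, h]

variable {A : Matrix (Fin n) (Fin n) ℝ} {η : ℝ}

/-- The vectors of one repetition satisfy the perturbed Chebyshev recurrence. -/
lemma repetition_spec (hO : IsAMV A η O) {N : ℕ} (hN : 1 ≤ N) (c : Config n) :
    (execProg O ω (repetition n N) c).coins = c.coins + n ∧
    ∃ v : ℕ → Vec n, v 0 = WithLp.toLp 2 (fun l : Fin n => sgn ω (c.coins + l)) ∧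
      ‖v 1 - mulCLM A (v 0)‖ ≤ η * ‖mulCLM A‖ * ‖v 0‖ ∧
      (∀ k, k + 2 ≤ N → ‖v (k + 2) - ((2 : ℝ) • mulCLM A (v (k + 1)) - v k)‖
        ≤ 2 * (η * ‖mulCLM A‖ * ‖v (k + 1)‖)) ∧
      ∀ k, 1 ≤ k → k ≤ N → (execProg O ω (repetition n N) c).mem .tau k
        = c.mem .tau k + inner ℝ (v 0) (v k) := by
  obtain ⟨N, rfl⟩ : ∃ N', N = N' + 1 := ⟨N - 1, by omega⟩
  rw [repetition, execProg_append, execProg_append, execProg_append, Nat.add_sub_cancel]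
  obtain ⟨s1, s2, s3⟩ := drawSigns_spec (O := O) (ω := ω) c
  set c1 := execProg O ω (drawSigns n) c
  set c2 := execProg O ω [.amv (.v 1) (.v 0)] c1 with hc2
  obtain ⟨a1, a2, a3⟩ := addMoment_spec (O := O) (ω := ω) 1 c2
  set c3 := execProg O ω (addMoment n 1) c2
  have h2v1 : c2.vec (.v 1) = O c1.past (c1.vec (.v 0)) := by
    ext l; simp [hc2, execProg, exec, Config.answer, Config.vec]
  have h2 : ∀ X j, X ≠ .v 1 → c2.mem X j = c1.mem X j := by
    intro X j hX; simp [hc2, execProg, exec, Config.answer, hX]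
  have h2c : c2.coins = c1.coins := rfl
  have h3v : ∀ k, c3.vec (.v k) = c2.vec (.v k) := fun k =>
    Config.vec_congr fun j => a3 _ _ (by simp) (by simp)
  have h2v0 : c2.vec (.v 0) = c1.vec (.v 0) := Config.vec_congr fun j => h2 _ _ (by simp)
  -- The last clause of the invariant says that later accumulators are untouched, so each moment is
  -- added to its value in the initial `c`.
  have h := execProg_forLoop (O := O) (ω := ω) (k := N) (c := c3)
    (body := fun i => recurrenceStep n (i + 2) ++ addMoment n (i + 2))
    (fun i c' => c'.coins = c.coins + n ∧ c'.vec (.v 0) = c1.vec (.v 0) ∧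
      ‖c'.vec (.v 1) - mulCLM A (c'.vec (.v 0))‖ ≤ η * ‖mulCLM A‖ * ‖c'.vec (.v 0)‖ ∧
      (∀ k, k + 2 ≤ i + 1 → ‖c'.vec (.v (k + 2)) -
          ((2 : ℝ) • mulCLM A (c'.vec (.v (k + 1))) - c'.vec (.v k))‖
        ≤ 2 * (η * ‖mulCLM A‖ * ‖c'.vec (.v (k + 1))‖)) ∧
      (∀ k, 1 ≤ k → k ≤ i + 1 → c'.mem .tau k
        = c.mem .tau k + inner ℝ (c'.vec (.v 0)) (c'.vec (.v k))) ∧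
      ∀ k, i + 1 < k → c'.mem .tau k = c.mem .tau k)
    (by
      refine ⟨a1.trans s1, by rw [h3v, h2v0], ?_, fun k hk => by omega, fun k hk1 hk2 => ?_,
        fun k hk => ?_⟩
      · rw [h3v, h3v, h2v0, h2v1]
        exact hO _ _
      · obtain rfl : k = 1 := by omega
        rw [h3v, h3v, a2, h2 _ _ (by simp), s3 _ _ (by simp)]
      · rw [a3 _ _ (by simp) (by omega), h2 _ _ (by simp), s3 _ _ (by simp)])
    (by
      rintro i hi c' ⟨i1, i2, i3, i4, i5, i6⟩
      rw [execProg_append]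
      obtain ⟨r1, r2, r3⟩ := recurrenceStep_spec (O := O) (ω := ω) i c'
      set c4 := execProg O ω (recurrenceStep n (i + 2)) c'
      obtain ⟨b1, b2, b3⟩ := addMoment_spec (O := O) (ω := ω) (i + 2) c4
      set c5 := execProg O ω (addMoment n (i + 2)) c4
      have h5v : ∀ k, c5.vec (.v k) = c4.vec (.v k) := fun k =>
        Config.vec_congr fun j => b3 _ _ (by simp) (by simp)
      have h4v : ∀ k, k ≠ i + 2 → c4.vec (.v k) = c'.vec (.v k) := fun k hk =>
        Config.vec_congr fun j => r3 _ _ (by simp) (by simp) (by simpa using hk)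
      simp only [h5v]
      refine ⟨(b1.trans r1).trans i1, (h4v 0 (by omega)).trans i2, ?_, fun k hk => ?_,
        fun k hk1 hk2 => ?_, fun k hk => ?_⟩
      · rw [h4v 0 (by omega), h4v 1 (by omega)]; exact i3
      · rw [h4v (k + 1) (by omega), h4v k (by omega)]
        by_cases hki : k = i
        · subst hki
          rw [r2, sub_sub_sub_cancel_right, ← smul_sub, norm_smul, Real.norm_eq_abs, abs_two]
          exact mul_le_mul_of_nonneg_left (hO _ _) zero_le_two
        · rw [h4v (k + 2) (by omega)]
          exact i4 k (by omega)
      · by_cases hki : k = i + 2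
        · subst hki
          rw [b2, r3 _ _ (by simp) (by simp) (by simp), i6 _ (by omega)]
        · rw [b3 _ _ (by simp) (fun _ => hki), r3 _ _ (by simp) (by simp) (by simp),
            i5 k hk1 (by omega), h4v 0 (by omega), h4v k hki]
      · rw [b3 _ _ (by simp) (by omega), r3 _ _ (by simp) (by simp) (by simp), i6 _ (by omega)])
  obtain ⟨f1, f2, f3, f4, f5, -⟩ := h
  -- The witnesses are the final contents of the arrays `v k`, which are not overwritten within a
  -- repetition.
  exact ⟨f1, fun k => Config.vec _ (.v k), f2.trans s2, f3, f4, f5⟩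

/-- Each repetition adds the exact quadratic forms up to a small error. -/
lemma repetition_moment (hA : A.IsHermitian) (hn : ‖mulCLM A‖ ≤ 1) (hη : 0 ≤ η)
    (hO : IsAMV A η O) {N : ℕ} (hN : 1 ≤ N) (hηN : 4 * η * (N : ℝ) ^ 2 ≤ 1) (i : ℕ)
    (c : Config n) (hc : c.coins = i * n) {k : ℕ} (hk1 : 1 ≤ k) (hk : k ≤ N) :
    |(execProg O ω (repetition n N) c).mem .tau k - c.mem .tau k
      - ∑ j, cheb k (hA.eigenvalues j) * signCoord hA.eigenvectorBasis ω i j ^ 2|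
      ≤ 4 * η * (N : ℝ) ^ 2 * n := by
  obtain ⟨-, v, hv0, hv1, hv2, hv3⟩ := repetition_spec (ω := ω) hO hN c
  have hη' : ∀ y : Vec n, η * ‖mulCLM A‖ * ‖y‖ ≤ η * ‖y‖ := fun y => by
    gcongr; exact mul_le_of_le_one_right hη hn
  have hv0' : v 0 = signVec n ω i := by rw [hv0, hc]; rfl
  have h := abs_inner_recurrence_sub_le hA hn hη hηN (v := v) (hv1.trans (hη' _))
    (fun k hk => (hv2 k hk).trans (by linarith [hη' (v (k + 1))])) hk
  rw [hv0', norm_sq_signVec] at h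
  rw [hv3 k hk1 hk, add_sub_cancel_left, hv0']
  exact h

lemma momentLoop_spec (hA : A.IsHermitian) (hn : ‖mulCLM A‖ ≤ 1) (hη : 0 ≤ η)
    (hO : IsAMV A η O) {N : ℕ} (hN : 1 ≤ N) (hηN : 4 * η * (N : ℝ) ^ 2 ≤ 1) (m : ℕ)
    (c : Config n) (hc : c.coins = 0) (ht : ∀ k, c.mem .tau k = 0) {k : ℕ} (hk1 : 1 ≤ k)
    (hk : k ≤ N) :
    |(execProg O ω (forLoop m fun _ => repetition n N) c).mem .tau k
      - ∑ i ∈ Finset.range m,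
        ∑ j, cheb k (hA.eigenvalues j) * signCoord hA.eigenvectorBasis ω i j ^ 2|
      ≤ m * (4 * η * (N : ℝ) ^ 2 * n) := by
  refine (execProg_forLoop (O := O) (ω := ω) (k := m) (body := fun _ => repetition n N) (c := c)
    (fun i c' => c'.coins = i * n ∧ |c'.mem .tau k - ∑ i ∈ Finset.range i,
        ∑ j, cheb k (hA.eigenvalues j) * signCoord hA.eigenvectorBasis ω i j ^ 2|
      ≤ i * (4 * η * (N : ℝ) ^ 2 * n)) ⟨by simpa using hc, by simp [ht]⟩ ?_).2
  rintro i - c' ⟨h1, h2⟩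
  refine ⟨?_, ?_⟩
  · rw [(repetition_spec hO hN c').1, h1]; ring
  · have h := repetition_moment (ω := ω) hA hn hη hO hN hηN i c' h1 hk1 hk
    rw [Finset.sum_range_succ]
    push_cast
    rw [abs_le] at h h2 ⊢
    constructor <;> linarith [h.1, h.2, h2.1, h2.2]

lemma scaleMoment_spec (N m : ℕ) (c : Config n) :
    ∀ k, 1 ≤ k → k ≤ N →
      (execProg O ω (forLoop N fun i => scaleMoment n m (i + 1)) c).mem .tau k
        = √(2 / Real.pi) / m / n * c.mem .tau k := by
  refine (execProg_forLoop (O := O) (ω := ω) (k := N) (c := c)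
    (body := fun i => scaleMoment n m (i + 1))
    (fun i c' => (∀ k, 1 ≤ k → k ≤ i → c'.mem .tau k = √(2 / Real.pi) / m / n * c.mem .tau k) ∧
      ∀ k, i < k → c'.mem .tau k = c.mem .tau k) ⟨fun k _ _ => by omega, fun _ _ => rfl⟩ ?_).1
  rintro i - c' ⟨h1, h2⟩
  refine ⟨fun k hk1 hk2 => ?_, fun k hk => ?_⟩
  · rcases Nat.le_succ_iff.1 hk2 with hk | rfl
    · have : k ≠ i + 1 := by omega
      simp [execProg, scaleMoment, exec, Config.write, Config.read, this, h1 k hk1 hk]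
    · simp [execProg, scaleMoment, exec, Config.write, Config.read, h2]
  · have : k ≠ i + 1 := by omega
    simp [execProg, scaleMoment, exec, Config.write, Config.read, this, h2 k (by omega)]

lemma initMoments_spec (N : ℕ) (c : Config n) (hc : c.coins = 0) (ht : ∀ k, c.mem .tau k = 0) :
    (execProg O ω (forLoop N fun i => [.lit (.tau, i + 1) 0]) c).coins = 0 ∧
    ∀ k, (execProg O ω (forLoop N fun i => [.lit (.tau, i + 1) 0]) c).mem .tau k = 0 := by
  refine execProg_forLoop (O := O) (ω := ω) (k := N) (c := c)
    (body := fun i => [.lit (.tau, i + 1) 0])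
    (fun _ c' => c'.coins = 0 ∧ ∀ k, c'.mem .tau k = 0) ⟨hc, ht⟩ ?_
  rintro i - c' ⟨h1, h2⟩
  refine ⟨by simp [execProg, exec, Config.write, h1], fun k => ?_⟩
  simp [execProg, exec, Config.write, h2]

lemma jacksonCoeff_spec (N k : ℕ) (c : Config n) :
    (execProg O ω (jacksonCoeff N k) c).mem .b k = jackson N k ∧
    ∀ X j, X ≠ .tmp → (X = .b → j ≠ k) →
      (execProg O ω (jacksonCoeff N k) c).mem X j = c.mem X j := by
  rw [jacksonCoeff, execProg_cons, jackson]
  refine execProg_forLoop (O := O) (ω := ω) (k := N + 3 - k)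
    (fun i c' => c'.mem .b k = ∑ i ∈ Finset.range i,
      tri (N / 2 + 1) (i - (N / 2 + 1 : ℕ)) * tri (N / 2 + 1) (i - (N / 2 + 1 : ℕ) + k) ∧
      ∀ X j, X ≠ .tmp → (X = .b → j ≠ k) → c'.mem X j = c.mem X j) ⟨?_, fun X j _ hj => ?_⟩ ?_
  · simp [exec, Config.write]
  · have : ¬(X = .b ∧ j = k) := fun h => hj h.1 h.2
    simp [exec, Config.write, this]
  · rintro i - c' ⟨h1, h2⟩
    refine ⟨?_, fun X j hX hj => ?_⟩
    · rw [Finset.sum_range_succ, ← h1]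
      simp [execProg, exec, Config.write, Config.read, tri]
    · have : ¬(X = .b ∧ j = k) := fun h => hj h.1 h.2
      simp [execProg, exec, Config.write, Config.read, this, hX, h2 X j hX hj]

lemma jacksonLoop_spec (N K : ℕ) (c : Config n) :
    (∀ k < K, (execProg O ω (forLoop K fun k => jacksonCoeff N k) c).mem .b k = jackson N k) ∧
    ∀ k, (execProg O ω (forLoop K fun k => jacksonCoeff N k) c).mem .tau k = c.mem .tau k := by
  refine execProg_forLoop (O := O) (ω := ω) (k := K) (c := c) (body := fun k => jacksonCoeff N k)
    (fun i c' => (∀ k < i, c'.mem .b k = jackson N k) ∧ ∀ k, c'.mem .tau k = c.mem .tau k)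
    ⟨by simp, fun _ => rfl⟩ ?_
  rintro i - c' ⟨h1, h2⟩
  obtain ⟨j1, j2⟩ := jacksonCoeff_spec (O := O) (ω := ω) N i c'
  refine ⟨fun k hk => ?_, fun k => ?_⟩
  · rcases Nat.lt_succ_iff_lt_or_eq.1 hk with hk | rfl
    · rw [j2 _ _ (by simp) (fun _ => hk.ne), h1 k hk]
    · exact j1
  · rw [j2 _ _ (by simp) (by simp), h2]

lemma dampedLoop_spec (K : ℕ) (c : Config n) :
    ∀ k < K, (execProg O ω (forLoop K fun k => dampedCoeff k) c).mem .a k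
      = c.mem .b k / c.mem .b 0 * c.mem .tau k := by
  refine (execProg_forLoop (O := O) (ω := ω) (k := K) (c := c) (body := fun k => dampedCoeff k)
    (fun i c' => (∀ k < i, c'.mem .a k = c.mem .b k / c.mem .b 0 * c.mem .tau k) ∧
      (∀ k, c'.mem .b k = c.mem .b k) ∧ ∀ k, c'.mem .tau k = c.mem .tau k)
    ⟨by simp, fun _ => rfl, fun _ => rfl⟩ ?_).1
  rintro i - c' ⟨h1, h2, h3⟩
  refine ⟨fun k hk => ?_, fun k => ?_, fun k => ?_⟩
  · rcases Nat.lt_succ_iff_lt_or_eq.1 hk with hk | rfl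
    · simp [execProg, dampedCoeff, exec, Config.write, Config.read, hk.ne, h1 k hk]
    · simp [execProg, dampedCoeff, exec, Config.write, Config.read, h2, h3]
  · simp [execProg, dampedCoeff, exec, Config.write, h2]
  · simp [execProg, dampedCoeff, exec, Config.write, h3]

/-- The coefficients returned by the method, in terms of the exact Hutchinson estimates. -/
lemma kpm_spec (hA : A.IsHermitian) (hn : ‖mulCLM A‖ ≤ 1) (hη : 0 ≤ η)
    (hO : IsAMV A η O) {N : ℕ} (hN : 1 ≤ N) (hηN : 4 * η * (N : ℝ) ^ 2 ≤ 1) (m : ℕ) :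
    ∃ t : ℕ → ℝ,
      (∀ k, 1 ≤ k → k ≤ N → |t k - ∑ i : Fin m,
        ∑ j, cheb k (hA.eigenvalues j) * signCoord hA.eigenvectorBasis ω i j ^ 2|
        ≤ m * (4 * η * (N : ℝ) ^ 2 * n)) ∧
      (run O ω (kpm n N m)).mem .a 0 = damping N 0 * (1 / √Real.pi) ∧
      ∀ k, 1 ≤ k → k ≤ N → (run O ω (kpm n N m)).mem .a k
        = damping N k * (√(2 / Real.pi) / m / n * t k) := by
  have e : run O ω (kpm n N m)
      = execProg O ω (kpm n N m) { mem := fun _ _ => 0, coins := 0, past := [] } := rfl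
  set c0 : Config n := { mem := fun _ _ => 0, coins := 0, past := [] } with hc0
  rw [e, kpm, momentEstimator]
  simp only [execProg_append]
  obtain ⟨i1, i2⟩ := initMoments_spec (O := O) (ω := ω) N c0 rfl fun _ => rfl
  set c1 := execProg O ω (forLoop N fun i => [.lit (.tau, i + 1) 0]) c0
  set c2 := execProg O ω (forLoop m fun _ => repetition n N) c1 with hc2
  have s := scaleMoment_spec (O := O) (ω := ω) N m c2
  set c3 := execProg O ω (forLoop N fun i => scaleMoment n m (i + 1)) c2
  set c4 := execProg O ω zerothMoment c3 with hc4
  have z0 : c4.mem .tau 0 = 1 / √Real.pi := by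
    simp [hc4, zerothMoment, execProg, exec, Config.write, Config.read]
  have z1 : ∀ k, 1 ≤ k → c4.mem .tau k = c3.mem .tau k := by
    intro k hk
    have : k ≠ 0 := by omega
    simp [hc4, zerothMoment, execProg, exec, Config.write, this]
  obtain ⟨b1, b2⟩ := jacksonLoop_spec (O := O) (ω := ω) N (N + 1) c4
  set c5 := execProg O ω (forLoop (N + 1) fun k => jacksonCoeff N k) c4
  have d := dampedLoop_spec (O := O) (ω := ω) (N + 1) c5
  refine ⟨fun k => c2.mem .tau k, fun k hk1 hk => ?_, ?_, fun k hk1 hk => ?_⟩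
  · rw [← Finset.sum_range (fun i => ∑ j, cheb k (hA.eigenvalues j) *
      signCoord hA.eigenvectorBasis ω i j ^ 2)]
    exact momentLoop_spec hA hn hη hO hN hηN m c1 i1 i2 hk1 hk
  · rw [d 0 (by omega), b1 0 (by omega), b2, z0, damping]
  · rw [d k (by omega), b1 0 (by omega), b1 k (by omega), b2, z1 k hk1, s k hk1 hk, damping]

end Semantics

/-! ### Running time -/

lemma steps_append (n : ℕ) (P Q : Prog) : Prog.steps n (P ++ Q) = P.steps n + Q.steps n := by
  simp [Prog.steps]

lemma calls_append (P Q : Prog) : Prog.calls (P ++ Q) = P.calls + Q.calls := by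
  simp [Prog.calls]

lemma forLoop_succ (k : ℕ) (body : ℕ → Prog) :
    forLoop (k + 1) body = forLoop k body ++ body k := by
  simp [forLoop, List.range_succ]

lemma steps_forLoop_le {n k s : ℕ} {body : ℕ → Prog} (h : ∀ i, (body i).steps n ≤ s) :
    Prog.steps n (forLoop k body) ≤ k * s := by
  induction k with
  | zero => simp [forLoop, Prog.steps]
  | succ k ih => rw [forLoop_succ, steps_append, add_mul, one_mul]; exact add_le_add ih (h k)

lemma calls_forLoop {k s : ℕ} {body : ℕ → Prog} (h : ∀ i, (body i).calls = s) :
    Prog.calls (forLoop k body) = k * s := by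
  induction k with
  | zero => simp [forLoop, Prog.calls]
  | succ k ih => rw [forLoop_succ, calls_append, add_mul, one_mul, ih, h k]

lemma calls_cons (i : Instr) (P : Prog) : Prog.calls (i :: P) = i.calls + Prog.calls P := by
  simp [Prog.calls]

lemma steps_cons (n : ℕ) (i : Instr) (P : Prog) :
    Prog.steps n (i :: P) = i.cost n + P.steps n := by
  simp [Prog.steps]

lemma calls_kpm (n m : ℕ) {N : ℕ} (hN : 1 ≤ N) : Prog.calls (kpm n N m) = m * N := by
  have h1 : ∀ k, (addMoment n k).calls = 0 := fun k => calls_forLoop (s := 0) fun _ => rfl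
  have h2 : ∀ k, (recurrenceStep n k).calls = 1 := fun k => by
    rw [recurrenceStep, calls_cons, calls_forLoop (s := 0) fun _ => rfl]; rfl
  have h3 : (repetition n N).calls = N := by
    rw [repetition, calls_append, calls_append, calls_append, h1, drawSigns,
      calls_forLoop (s := 0) (fun _ => rfl),
      calls_forLoop (s := 1) (fun i => by rw [calls_append, h1, h2])]
    simp only [Prog.calls, Instr.calls, List.map, List.sum_cons, List.sum_nil]
    omega
  have h4 : ∀ k, (jacksonCoeff N k).calls = 0 := fun k => by
    rw [jacksonCoeff, calls_cons, calls_forLoop (s := 0) fun _ => rfl]; rfl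
  rw [kpm, momentEstimator]
  simp only [calls_append]
  rw [calls_forLoop (s := 0) (fun _ => rfl), calls_forLoop (s := N) (fun _ => h3),
    calls_forLoop (s := 0) (fun _ => rfl), calls_forLoop (s := 0) h4,
    calls_forLoop (s := 0) (fun _ => rfl)]
  simp [zerothMoment, Prog.calls, Instr.calls]

/-- The N² term pays for summing every Jackson coefficient directly; 52 absorbs 4N² + 29N + 19 for N
≥ 1. -/
lemma steps_kpm_le (n m : ℕ) {N : ℕ} (hN : 1 ≤ N) :
    Prog.steps n (kpm n N m) ≤ 6 * m * n * N + 52 * N ^ 2 := by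
  have h1 : ∀ k, (addMoment n k).steps n ≤ n * 2 := fun k => steps_forLoop_le fun _ => le_rfl
  have h2 : ∀ k, (recurrenceStep n k).steps n ≤ n * 4 := fun k => by
    rw [recurrenceStep, steps_cons]
    refine (add_le_add_right (steps_forLoop_le (s := 3) fun _ => le_rfl) _).trans ?_
    simp only [Instr.cost]; omega
  have h3 : (repetition n N).steps n ≤ 6 * n * N := by
    obtain ⟨N, rfl⟩ : ∃ N', N = N' + 1 := ⟨N - 1, by omega⟩
    rw [repetition, steps_append, steps_append, steps_append]
    have e1 : (drawSigns n).steps n ≤ n * 1 := steps_forLoop_le fun _ => le_rfl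
    have e2 := h1 1
    have e3 : Prog.steps n (forLoop (N + 1 - 1) fun i =>
        recurrenceStep n (i + 2) ++ addMoment n (i + 2)) ≤ N * (n * 4 + n * 2) :=
      steps_forLoop_le fun i => by rw [steps_append]; exact add_le_add (h2 _) (h1 _)
    have e4 : Prog.steps n [.amv (.v 1) (.v 0)] = n := by simp [Prog.steps, Instr.cost]
    rw [e4]
    nlinarith
  have h4 : ∀ k, (jacksonCoeff N k).steps n ≤ 1 + (N + 3) * 4 := fun k => by
    rw [jacksonCoeff, steps_cons]
    refine add_le_add le_rfl ((steps_forLoop_le (s := 4) fun _ => le_rfl).trans ?_)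
    exact Nat.mul_le_mul_right _ (Nat.sub_le _ _)
  rw [kpm, momentEstimator]
  simp only [steps_append]
  have e1 : Prog.steps n (forLoop N fun i => [.lit (.tau, i + 1) 0]) ≤ N * 1 :=
    steps_forLoop_le fun _ => le_rfl
  have e2 : Prog.steps n (forLoop m fun _ => repetition n N) ≤ m * (6 * n * N) :=
    steps_forLoop_le fun _ => h3
  have e3 : Prog.steps n (forLoop N fun i => scaleMoment n m (i + 1)) ≤ N * 9 :=
    steps_forLoop_le fun _ => le_rfl
  have e4 : Prog.steps n (forLoop (N + 1) fun k => jacksonCoeff N k)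
      ≤ (N + 1) * (1 + (N + 3) * 4) := steps_forLoop_le h4
  have e5 : Prog.steps n (forLoop (N + 1) fun k => dampedCoeff k) ≤ (N + 1) * 2 :=
    steps_forLoop_le fun _ => le_rfl
  have e6 : Prog.steps n zerothMoment = 4 := rfl
  rw [e6]
  nlinarith

/-! ### Parameters -/

section Parameters

variable {n : ℕ} {ε δ : ℝ}

/-- The lower bound gives L = N/2 ≥ 10/ε, hence 9/L ≤ ε. The upper bound uses ⌈1/ε⌉ ≤ 2/ε. -/
lemma degree_bounds (hε : 0 < ε) (hε1 : ε < 1) :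
    20 / ε ≤ (degree 5 ε : ℝ) ∧ (degree 5 ε : ℝ) ≤ 40 / ε := by
  have h1 : 1 < 1 / ε := (one_lt_div hε).2 hε1
  have h2 := Nat.le_ceil (1 / ε)
  have h3 := Nat.ceil_lt_add_one (by positivity : 0 ≤ 1 / ε)
  have e1 : 20 / ε = 20 * (1 / ε) := by ring
  have e2 : 40 / ε = 40 * (1 / ε) := by ring
  rw [degree, e1, e2]
  push_cast
  constructor <;> linarith

lemma log_one_div_mul_pos (hε : 0 < ε) (hε1 : ε < 1) (hδ : 0 < δ) (hδ1 : δ < 1) :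
    0 < Real.log (1 / (ε * δ)) := by
  refine Real.log_pos ((one_lt_div (by positivity)).2 ?_)
  nlinarith

lemma le_mul_repCount (hn : 0 < n) :
    (n : ℝ) ≤ n * repCount 1 n ε δ ∧
    (ε ^ 4)⁻¹ * Real.log (1 / (ε * δ)) ^ 2 ≤ n * repCount 1 n ε δ := by
  have hn' : (0 : ℝ) < n := by exact_mod_cast hn
  constructor
  · exact le_mul_of_one_le_right hn'.le (le_max_left _ _)
  · have h : 1 / (n : ℝ) * (ε ^ 4)⁻¹ * Real.log (1 / (ε * δ)) ^ 2 ≤ repCount 1 n ε δ :=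
      le_max_right _ _
    have h2 := mul_le_mul_of_nonneg_left h hn'.le
    refine le_trans (le_of_eq ?_) h2
    field_simp

/-- Absorbs the N² cost of the Jackson coefficients into nℓ/ε. The logarithm may be close to 0, but
only when ε is near 1; there n ≥ 1 suffices. -/
lemma one_div_le_mul_repCount (hn : 0 < n) (hε : 0 < ε) (hε1 : ε < 1) (hδ : 0 < δ) (hδ1 : δ < 1) :
    1 / ε ≤ 4 * (n * repCount 1 n ε δ) := by
  obtain ⟨h1, h2⟩ := le_mul_repCount (ε := ε) (δ := δ) hn
  have hn' : (1 : ℝ) ≤ n := by exact_mod_cast hn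
  by_cases he : 1 / 2 < ε
  · have : 1 / ε ≤ 2 := by rw [div_le_iff₀ hε]; linarith
    linarith
  · have hlog : 1 / 2 ≤ Real.log (1 / (ε * δ)) := by
      have h3 : (2 : ℝ) ≤ 1 / (ε * δ) := by rw [le_div_iff₀ (by positivity)]; nlinarith
      have h4 := Real.log_le_log (by norm_num) h3
      linarith [Real.log_two_gt_d9]
    have hinv : 1 ≤ ε⁻¹ := (one_le_inv₀ hε).2 hε1.le
    have h5 : ε⁻¹ ≤ (ε ^ 4)⁻¹ := by
      rw [← inv_pow]; exact le_self_pow₀ hinv (by norm_num)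
    have h6 : (ε ^ 4)⁻¹ * (1 / 4) ≤ (ε ^ 4)⁻¹ * Real.log (1 / (ε * δ)) ^ 2 := by
      gcongr; nlinarith
    rw [one_div]
    linarith

/-- The union bound asks for 1 + log, while ℓ contains log². If the logarithm x is at least 1/2,
then 1 + x ≤ 6x²; otherwise ε⁻⁴ ≤ e² ≤ 8 and the left side is at most 12. -/
lemma log_bound_le_mul_repCount (hn : 0 < n) (hε : 0 < ε) (hε1 : ε < 1) (hδ : 0 < δ)
    (hδ1 : δ < 1) :
    (ε ^ 4)⁻¹ * (1 + Real.log (1 / (ε * δ))) ≤ 12 * (n * repCount 1 n ε δ) := by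
  obtain ⟨h1, h2⟩ := le_mul_repCount (ε := ε) (δ := δ) hn
  have hn' : (1 : ℝ) ≤ n := by exact_mod_cast hn
  have hx0 := log_one_div_mul_pos hε hε1 hδ hδ1
  set x := Real.log (1 / (ε * δ)) with hx
  by_cases h : 1 / 2 ≤ x
  · have : (ε ^ 4)⁻¹ * (1 + x) ≤ (ε ^ 4)⁻¹ * (6 * x ^ 2) := by gcongr; nlinarith
    have h3 : 0 ≤ (ε ^ 4)⁻¹ * x ^ 2 := by positivity
    linarith
  · push Not at h
    have h3 : ε⁻¹ ≤ Real.exp x := by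
      rw [hx, Real.exp_log (by positivity), one_div, mul_inv]
      exact le_mul_of_one_le_right (by positivity) ((one_le_inv₀ hδ).2 hδ1.le)
    have h4 : (ε ^ 4)⁻¹ ≤ 8 := by
      calc (ε ^ 4)⁻¹ = ε⁻¹ ^ 4 := (inv_pow _ _).symm
        _ ≤ Real.exp x ^ 4 := by gcongr
        _ = Real.exp (4 * x) := by rw [← Real.exp_nat_mul]; norm_num
        _ ≤ Real.exp 2 := Real.exp_le_exp.2 (by linarith)
        _ = Real.exp 1 ^ 2 := by rw [← Real.exp_nat_mul]; norm_num
        _ ≤ 2.72 ^ 2 := by gcongr; linarith [Real.exp_one_lt_d9]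
        _ ≤ 8 := by norm_num
    have : (ε ^ 4)⁻¹ * (1 + x) ≤ 8 * (1 + 1 / 2) := by gcongr
    linarith

/-- The factor `ρ` in the number of repetitions. -/
abbrev repFactor : ℕ := 256 * 40 ^ 4 * 5 * 12

lemma repetitions_le {ρ : ℕ} : (repetitions ρ 1 n ε δ : ℝ) ≤ 2 * ρ * repCount 1 n ε δ := by
  have h1 : 1 ≤ repCount 1 n ε δ := le_max_left _ _
  have h := Nat.ceil_lt_add_one (by linarith : 0 ≤ repCount 1 n ε δ)
  rw [repetitions]
  push_cast
  have : (⌈repCount 1 n ε δ⌉₊ : ℝ) ≤ 2 * repCount 1 n ε δ := by linarith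
  calc _ ≤ (ρ : ℝ) * (2 * repCount 1 n ε δ) := by gcongr
    _ = _ := by ring

lemma degree_pow_four_le (hε : 0 < ε) (hε1 : ε < 1) : (degree 5 ε : ℝ) ^ 4 ≤ 40 ^ 4 * (ε ^ 4)⁻¹ := by
  have h := (degree_bounds hε hε1).2
  calc _ ≤ (40 / ε) ^ 4 := by gcongr
    _ = _ := by rw [div_pow]; rfl

/-- The number of repetitions suffices for a union bound over all moments. -/
lemma union_bound_le (hn : 0 < n) (hε : 0 < ε) (hε1 : ε < 1) (hδ : 0 < δ) (hδ1 : δ < 1) :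
    (degree 5 ε : ℝ) * (2 * Real.exp (-((repetitions repFactor 1 n ε δ : ℝ) * n
      * (1 / (2 * (degree 5 ε : ℝ) ^ 2)) ^ 2 / 64))) ≤ δ := by
  obtain ⟨hN1, hN2⟩ := degree_bounds hε hε1
  have hN4 := degree_pow_four_le hε hε1
  set N : ℝ := (degree 5 ε : ℝ)
  have hN0 : 0 < N := lt_of_lt_of_le (by positivity) hN1
  have hx0 := log_one_div_mul_pos hε hε1 hδ hδ1
  have hlog : Real.log (2 * N / δ) ≤ 5 * (1 + Real.log (1 / (ε * δ))) := by
    have h80 : Real.log 80 ≤ 5 := by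
      rw [Real.log_le_iff_le_exp (by norm_num)]
      calc (80 : ℝ) ≤ 2.7 ^ 5 := by norm_num
        _ ≤ Real.exp 1 ^ 5 := by gcongr; linarith [Real.exp_one_gt_d9]
        _ = Real.exp 5 := by rw [← Real.exp_nat_mul]; norm_num
    have h1 : 2 * N / δ ≤ 80 * (1 / (ε * δ)) := by
      calc _ ≤ 2 * (40 / ε) / δ := by gcongr
        _ = _ := by field_simp; norm_num
    have h2 := Real.log_le_log (by positivity) h1
    rw [Real.log_mul (by norm_num) (by positivity)] at h2
    linarith
  have hm : (repFactor : ℝ) * (n * repCount 1 n ε δ) ≤ (repetitions repFactor 1 n ε δ : ℝ) * n := by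
    have := Nat.le_ceil (repCount 1 n ε δ)
    rw [repetitions]
    calc _ = (repFactor : ℝ) * repCount 1 n ε δ * n := by ring
      _ ≤ (repFactor : ℝ) * ⌈repCount 1 n ε δ⌉₊ * n := by gcongr
      _ = _ := by push_cast; ring
  -- For t = 1/(2N²), t²/64 = 1/(256N⁴). The remaining factors of `repFactor` come from N ≤ 40/ε,
  -- from `hlog`, and from the comparison of 1 + log with ℓ.
  have hkey : 256 * N ^ 4 * Real.log (2 * N / δ) ≤ (repetitions repFactor 1 n ε δ : ℝ) * n := by
    have h1 := log_bound_le_mul_repCount hn hε hε1 hδ hδ1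
    calc 256 * N ^ 4 * Real.log (2 * N / δ)
        ≤ 256 * N ^ 4 * (5 * (1 + Real.log (1 / (ε * δ)))) := by gcongr
      _ ≤ 256 * (40 ^ 4 * (ε ^ 4)⁻¹) * (5 * (1 + Real.log (1 / (ε * δ)))) := by gcongr
      _ = 256 * 40 ^ 4 * 5 * ((ε ^ 4)⁻¹ * (1 + Real.log (1 / (ε * δ)))) := by ring
      _ ≤ 256 * 40 ^ 4 * 5 * (12 * (n * repCount 1 n ε δ)) := by gcongr
      _ = (repFactor : ℝ) * (n * repCount 1 n ε δ) := by rw [repFactor]; push_cast; ring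
      _ ≤ _ := hm
  set M : ℝ := (repetitions repFactor 1 n ε δ : ℝ) * n
  have e : M * (1 / (2 * N ^ 2)) ^ 2 / 64 = M / (256 * N ^ 4) := by field_simp; ring
  have h2 : Real.log (2 * N / δ) ≤ M / (256 * N ^ 4) := by
    rw [le_div_iff₀ (by positivity)]; linarith
  have h3 : Real.exp (-(M / (256 * N ^ 4))) ≤ (2 * N / δ)⁻¹ := by
    rw [← Real.exp_log (by positivity : 0 < 2 * N / δ), ← Real.exp_neg]
    exact Real.exp_le_exp.2 (by linarith)
  rw [e]
  calc _ ≤ N * (2 * (2 * N / δ)⁻¹) := by gcongr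
    _ = δ := by field_simp

end Parameters

/-! ### The Wasserstein distance -/

lemma integral_spectralDensity {n : ℕ} {A : Matrix (Fin n) (Fin n) ℝ} (hA : A.IsHermitian)
    (f : ℝ → ℝ) : ∫ x, f x ∂(spectralDensity hA) = ∑ j, (n : ℝ)⁻¹ * f (hA.eigenvalues j) := by
  rw [spectralDensity, integral_smul_measure, integral_finsetSum_measure fun i _ =>
    integrable_dirac (by simp)]
  simp [Finset.mul_sum]

lemma integral_densityMeasure {q : ℝ → ℝ} (hq : IsDensity q) (f : ℝ → ℝ) :
    ∫ x, f x ∂(densityMeasure q) = ∫ x in Icc (-1 : ℝ) 1, q x * f x := by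
  rw [densityMeasure, integral_withDensity_eq_integral_toReal_smul₀
    hq.integrable.aestronglyMeasurable.aemeasurable.ennreal_ofReal
    (Filter.Eventually.of_forall fun _ => ENNReal.ofReal_lt_top)]
  refine setIntegral_congr_fun measurableSet_Icc fun x hx => ?_
  simp [ENNReal.toReal_ofReal (hq.nonneg x hx)]

/-! ### Combining robustness, oracle error and concentration. -/

section Main

variable {n : ℕ} {A : Matrix (Fin n) (Fin n) ℝ} {O : Oracle n} {ω : ℕ → Bool}

/-- If the computed sums are close to the moments of weights `p` on the eigenvalues, the returned
function is a density that is close to these weights in the Wasserstein distance. -/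
lemma kpmDensity_robust (hA : A.IsHermitian) (hn : ‖mulCLM A‖ ≤ 1) (hn0 : 0 < n) {L m : ℕ}
    (hL : 0 < L) (hm : 0 < m) {t : ℕ → ℝ} {p : Fin n → ℝ} (hp : ∀ j, 0 ≤ p j)
    (hp1 : ∑ j, p j = 1)
    (ht : ∀ k, 1 ≤ k → k ≤ 2 * L → |t k - m * n * ∑ j, p j * cheb k (hA.eigenvalues j)|
      ≤ m * n / ((2 * L : ℕ) : ℝ) ^ 2)
    (h0 : (run O ω (kpm n (2 * L) m)).mem .a 0 = damping (2 * L) 0 * (1 / √Real.pi))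
    (ha : ∀ k, 1 ≤ k → k ≤ 2 * L → (run O ω (kpm n (2 * L) m)).mem .a k
        = damping (2 * L) k * (√(2 / Real.pi) / m / n * t k)) :
    IsDensity (kpmDensity (2 * L) m O ω) ∧ ∀ f : ℝ → ℝ, LipschitzWith 1 f →
      |∑ j, p j * f (hA.eigenvalues j)
        - ∫ x in Icc (-1 : ℝ) 1, kpmDensity (2 * L) m O ω x * f x| ≤ 9 / L := by
  have hn' : (0 : ℝ) < n := by exact_mod_cast hn0
  have hm' : (0 : ℝ) < m := by exact_mod_cast hm
  have hxs : ∀ j, hA.eigenvalues j ∈ Icc (-1 : ℝ) 1 := fun j =>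
    abs_le.1 (abs_eigenvalues_le_one hA hn j)
  have hs : √(2 / Real.pi) ≤ 1 := by
    rw [Real.sqrt_le_one, div_le_one Real.pi_pos]
    exact Real.two_le_pi
  -- The zeroth moment is exact, so its error is set to 0.
  set e : ℕ → ℝ := fun k => if k = 0 then 0 else
    √(2 / Real.pi) / m / n * (t k - m * n * ∑ j, p j * cheb k (hA.eigenvalues j)) with he
  have he1 : ∀ k, 1 ≤ k → k ≤ 2 * L → |e k| ≤ 1 / ((2 * L : ℕ) : ℝ) ^ 2 := by
    intro k hk1 hk
    rw [he]
    simp only [if_neg (by omega : k ≠ 0)]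
    rw [abs_mul, abs_of_nonneg (by positivity : 0 ≤ √(2 / Real.pi) / m / n)]
    calc _ ≤ 1 / m / n * (m * n / ((2 * L : ℕ) : ℝ) ^ 2) := by
          gcongr; exact ht k hk1 hk
      _ = _ := by field_simp
  have hae : ∀ k ≤ 2 * L, (run O ω (kpm n (2 * L) m)).mem .a k
      = damping (2 * L) k * (∑ j, p j * chebBar k (hA.eigenvalues j) + e k) := by
    intro k hk
    rcases Nat.eq_zero_or_pos k with rfl | hk1
    · rw [h0, he]
      simp only [chebBar_zero, ← Finset.sum_mul, hp1, if_pos]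
      ring
    · rw [ha k hk1 hk, he]
      simp only [if_neg hk1.ne', chebBar_of_pos hk1, mul_left_comm (p _), ← Finset.mul_sum]
      congr 1
      field_simp
      ring
  exact ⟨isDensity_outputDensity hL hp hp1 hxs (if_pos rfl) he1 hae,
    fun f hf => abs_sub_integral_outputDensity_le hL hp hp1 hxs (if_pos rfl) he1 hae hf⟩

/-- The returned function is always a density, and it is close to the spectral density as soon as
Hutchinson's estimates of all moments are accurate. -/
lemma kpmDensity_isDensity_and_close (hA : A.IsHermitian) (hn : ‖mulCLM A‖ ≤ 1) (hn0 : 0 < n) {L m : ℕ}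
    (hL : 0 < L) (hm : 0 < m) {η : ℝ} (hη : 0 ≤ η) (hO : IsAMV A η O)
    (hηN : 8 * η * ((2 * L : ℕ) : ℝ) ^ 4 ≤ 1) :
    IsDensity (kpmDensity (2 * L) m O ω) ∧
    ((∀ k, 1 ≤ k → k ≤ 2 * L → |∑ i : Fin m, ∑ j, cheb k (hA.eigenvalues j) *
        signCoord hA.eigenvectorBasis ω i j ^ 2 - m * ∑ j, cheb k (hA.eigenvalues j)|
        ≤ 1 / (2 * ((2 * L : ℕ) : ℝ) ^ 2) * (m * n)) →
      ∀ f : ℝ → ℝ, LipschitzWith 1 f → |∑ j, (n : ℝ)⁻¹ * f (hA.eigenvalues j)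
        - ∫ x in Icc (-1 : ℝ) 1, kpmDensity (2 * L) m O ω x * f x| ≤ 9 / L) := by
  have hn' : (0 : ℝ) < n := by exact_mod_cast hn0
  have hm' : (0 : ℝ) < m := by exact_mod_cast hm
  set N : ℕ := 2 * L with hN
  have hN1 : (1 : ℝ) ≤ (N : ℝ) := by exact_mod_cast (by omega : 1 ≤ N)
  have hη2 : 4 * η * (N : ℝ) ^ 2 ≤ 1 / (2 * (N : ℝ) ^ 2) := by
    rw [le_div_iff₀ (by positivity)]; linarith
  have hη1 : 4 * η * (N : ℝ) ^ 2 ≤ 1 := by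
    refine hη2.trans ?_
    rw [div_le_one (by positivity)]; nlinarith
  obtain ⟨t, ht, h0, ha⟩ := kpm_spec (ω := ω) hA hn hη hO (by omega : 1 ≤ N) hη1 m
  have ht' : ∀ k, 1 ≤ k → k ≤ N → |t k - ∑ i : Fin m,
        ∑ j, cheb k (hA.eigenvalues j) * signCoord hA.eigenvectorBasis ω i j ^ 2|
        ≤ 1 / (2 * (N : ℝ) ^ 2) * (m * n) := by
    intro k hk1 hk
    refine (ht k hk1 hk).trans ?_
    calc _ = 4 * η * (N : ℝ) ^ 2 * (m * n) := by ring
      _ ≤ _ := by gcongr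
  -- The budget 1/N² is split evenly between oracle error and Hutchinson deviation.
  have hhalf : (m : ℝ) * n / (N : ℝ) ^ 2
      = 1 / (2 * (N : ℝ) ^ 2) * (m * n) + 1 / (2 * (N : ℝ) ^ 2) * (m * n) := by
    field_simp; ring
  have hpos : 0 ≤ 1 / (2 * (N : ℝ) ^ 2) * (m * n) := by positivity
  constructor
  · refine (kpmDensity_robust hA hn hn0 hL hm (t := t)
      (p := fun j => (∑ i : Fin m, signCoord hA.eigenvectorBasis ω i j ^ 2) / (m * n))
      (fun j => by positivity) ?_ (fun k hk1 hk => ?_) h0 ha).1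
    · rw [← Finset.sum_div, Finset.sum_comm]
      simp only [sum_signCoord_sq]
      simp [hn'.ne', hm'.ne']
    · have e : (m : ℝ) * n * ∑ j, (∑ i : Fin m, signCoord hA.eigenvectorBasis ω i j ^ 2) / (m * n)
          * cheb k (hA.eigenvalues j) = ∑ i : Fin m,
        ∑ j, cheb k (hA.eigenvalues j) * signCoord hA.eigenvectorBasis ω i j ^ 2 := by
        rw [Finset.sum_comm, Finset.mul_sum]
        refine Finset.sum_congr rfl fun j _ => ?_
        rw [← Finset.mul_sum]
        field_simp
      rw [e, hhalf]
      linarith [ht' k hk1 hk]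
  · intro hdev
    refine (kpmDensity_robust hA hn hn0 hL hm (t := t) (p := fun _ => (n : ℝ)⁻¹)
      (fun j => by positivity) (by simp [hn'.ne']) (fun k hk1 hk => ?_) h0 ha).2
    rw [← Finset.mul_sum, mul_assoc, mul_inv_cancel_left₀ hn'.ne', hhalf]
    exact (abs_sub_le _ _ _).trans (add_le_add (ht' k hk1 hk) (hdev k hk1 hk))

/-- With high probability all moments are estimated accurately at once. -/
lemma coinLaw_deviation_le (hA : A.IsHermitian) (hn : ‖mulCLM A‖ ≤ 1) {N m : ℕ} (hN : 1 ≤ N)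
    {δ : ℝ}
    (hδ : (N : ℝ) * (2 * Real.exp (-((m : ℝ) * n * (1 / (2 * (N : ℝ) ^ 2)) ^ 2 / 64))) ≤ δ) :
    coinLaw {ω | ¬ ∀ k, 1 ≤ k → k ≤ N → |∑ i : Fin m, ∑ j, cheb k (hA.eigenvalues j) *
        signCoord hA.eigenvectorBasis ω i j ^ 2 - m * ∑ j, cheb k (hA.eigenvalues j)|
        ≤ 1 / (2 * (N : ℝ) ^ 2) * (m * n)} ≤ ENNReal.ofReal δ := by
  have hN1 : (1 : ℝ) ≤ (N : ℝ) := by exact_mod_cast hN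
  have ht1 : 1 / (2 * (N : ℝ) ^ 2) ≤ 1 := by
    rw [div_le_one (by positivity)]; nlinarith
  set E := Real.exp (-((m : ℝ) * n * (1 / (2 * (N : ℝ) ^ 2)) ^ 2 / 64))
  calc _ ≤ coinLaw (⋃ k ∈ Finset.Icc 1 N, {ω | 1 / (2 * (N : ℝ) ^ 2) * (m * n) <
          |∑ i : Fin m, ∑ j, cheb k (hA.eigenvalues j) *
        signCoord hA.eigenvectorBasis ω i j ^ 2 - m * ∑ j, cheb k (hA.eigenvalues j)|}) := by
        refine measure_mono fun ω hω => ?_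
        simp only [mem_ofPred_eq, not_forall, not_le] at hω
        obtain ⟨k, h1, h2, h3⟩ := hω
        simp only [mem_iUnion]
        exact ⟨k, Finset.mem_Icc.2 ⟨h1, h2⟩, h3⟩
    _ ≤ ∑ k ∈ Finset.Icc 1 N, coinLaw {ω | 1 / (2 * (N : ℝ) ^ 2) * (m * n) <
          |∑ i : Fin m, ∑ j, cheb k (hA.eigenvalues j) *
        signCoord hA.eigenvectorBasis ω i j ^ 2 - m * ∑ j, cheb k (hA.eigenvalues j)|} :=
        measure_biUnion_finset_le _ _
    _ ≤ ∑ _k ∈ Finset.Icc 1 N, 2 * ENNReal.ofReal E :=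
        Finset.sum_le_sum fun k _ => coinLaw_hutchinson_le _
          (fun j => abs_cheb_le_one k (abs_le.1 (abs_eigenvalues_le_one hA hn j)))
          (by positivity) ht1
    _ = ENNReal.ofReal (N * (2 * E)) := by
        rw [Finset.sum_const, Nat.card_Icc, Nat.add_sub_cancel, nsmul_eq_mul,
          ENNReal.ofReal_mul (Nat.cast_nonneg _), ENNReal.ofReal_mul zero_le_two]
        simp
    _ ≤ _ := ENNReal.ofReal_le_ofReal hδ

end Main

end KPM
end

theorem theorem2 :
    ∃ C C' C'' K : ℝ, ∃ κ ρ : ℕ,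
      0 < C ∧ 0 < C' ∧ 0 < C'' ∧ C'' < 1 ∧ 0 < K ∧ 0 < κ ∧ 0 < ρ ∧
      ∀ n : ℕ, 0 < n → ∀ ε δ : ℝ, 0 < ε → ε < 1 → 0 < δ → δ < 1 →
        ((KPM.Prog.calls (KPM.kpm n (KPM.degree κ ε) (KPM.repetitions ρ C' n ε δ)) : ℕ) : ℝ)
            ≤ C * KPM.repCount C' n ε δ / ε ∧
        ((KPM.Prog.steps n (KPM.kpm n (KPM.degree κ ε) (KPM.repetitions ρ C' n ε δ)) : ℕ) : ℝ)
            ≤ K * (n * KPM.repCount C' n ε δ / ε) ∧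
        ∀ (A : Matrix (Fin n) (Fin n) ℝ) (hA : A.IsHermitian), ‖KPM.mulCLM A‖ ≤ 1 →
          ∀ O : KPM.Oracle n, KPM.IsAMV A (C'' * ε ^ 4) O →
            (∀ ω : ℕ → Bool, KPM.IsDensity
              (KPM.kpmDensity (KPM.degree κ ε) (KPM.repetitions ρ C' n ε δ) O ω)) ∧
            ENNReal.ofReal (1 - δ) ≤
              KPM.coinLaw {ω | KPM.W1 (KPM.spectralDensity hA)
                (KPM.densityMeasure
                  (KPM.kpmDensity (KPM.degree κ ε) (KPM.repetitions ρ C' n ε δ) O ω))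
                ≤ ENNReal.ofReal ε} := by
  -- With m ≤ 2ρℓ and N ≤ 40/ε, the calls mN give 80ρ and the time gives 6 · 2 · 40 ρ + 52 · 40² ·
  -- 4. C'' makes 8 ε_MV N⁴ ≤ 1, and κ = 5 makes 9/L ≤ ε.
  refine ⟨80 * KPM.repFactor, 1, 1 / (8 * 40 ^ 4), 480 * KPM.repFactor + 52 * 1600 * 4, 5,
    KPM.repFactor, by norm_num, by norm_num, by norm_num, by norm_num, by norm_num, by norm_num,
    by norm_num, ?_⟩
  intro n hn ε δ hε hε1 hδ hδ1
  obtain ⟨hN1, hN2⟩ := KPM.degree_bounds hε hε1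
  have hub := KPM.union_bound_le hn hε hε1 hδ hδ1
  have hN4 := KPM.degree_pow_four_le hε hε1
  have hm2 : (KPM.repetitions KPM.repFactor 1 n ε δ : ℝ)
      ≤ 2 * KPM.repFactor * KPM.repCount 1 n ε δ := KPM.repetitions_le
  have hnl := KPM.one_div_le_mul_repCount hn hε hε1 hδ hδ1
  have hl1 : 1 ≤ KPM.repCount 1 n ε δ := le_max_left _ _
  have hm : 0 < KPM.repetitions KPM.repFactor 1 n ε δ :=
    Nat.mul_pos (by norm_num) (Nat.ceil_pos.2 (by linarith))
  generalize KPM.repFactor = ρ at *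
  set m := KPM.repetitions ρ 1 n ε δ
  set l := KPM.repCount 1 n ε δ
  have hceil : 0 < ⌈1 / ε⌉₊ := Nat.ceil_pos.2 (by positivity)
  obtain ⟨L, hL, hNL⟩ : ∃ L, 0 < L ∧ KPM.degree 5 ε = 2 * L :=
    ⟨10 * ⌈1 / ε⌉₊, by omega, by rw [KPM.degree]; ring⟩
  rw [hNL] at hN1 hN2 hub hN4 ⊢
  refine ⟨?_, ?_, fun A hA hAn O hO => ?_⟩
  · rw [KPM.calls_kpm _ _ (by omega)]
    push_cast at hN2 ⊢
    calc (m : ℝ) * (2 * L) ≤ (2 * ρ * l) * (40 / ε) := by gcongr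
      _ = _ := by ring
  · have h : ((KPM.Prog.steps n (KPM.kpm n (2 * L) m) : ℕ) : ℝ)
        ≤ 6 * m * n * (2 * L : ℕ) + 52 * ((2 * L : ℕ) : ℝ) ^ 2 := by
      exact_mod_cast KPM.steps_kpm_le n m (by omega : 1 ≤ 2 * L)
    refine h.trans ?_
    calc _ ≤ 6 * (2 * ρ * l) * n * (40 / ε) + 52 * (40 / ε) ^ 2 := by gcongr
      _ = 480 * ρ * (n * l / ε) + 52 * 1600 * (1 / ε) * (1 / ε) := by ring
      _ ≤ 480 * ρ * (n * l / ε) + 52 * 1600 * (4 * (n * l)) * (1 / ε) := by gcongr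
      _ = _ := by ring
  · have hη : (0 : ℝ) ≤ 1 / (8 * 40 ^ 4) * ε ^ 4 := by positivity
    have hηN : 8 * (1 / (8 * 40 ^ 4) * ε ^ 4) * ((2 * L : ℕ) : ℝ) ^ 4 ≤ 1 := by
      calc _ ≤ 8 * (1 / (8 * 40 ^ 4) * ε ^ 4) * (40 ^ 4 * (ε ^ 4)⁻¹) := by gcongr
        _ = 1 := by field_simp
    have hmain := fun ω => KPM.kpmDensity_isDensity_and_close (ω := ω) hA hAn hn hL hm hη hO hηN
    refine ⟨fun ω => (hmain ω).1, ?_⟩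
    have hbad := KPM.coinLaw_deviation_le hA hAn (N := 2 * L) (m := m) (by omega) hub
    have hW : ∀ ω, (∀ k, 1 ≤ k → k ≤ 2 * L → |∑ i : Fin m, ∑ j, KPM.cheb k (hA.eigenvalues j) *
        KPM.signCoord hA.eigenvectorBasis ω i j ^ 2 - m * ∑ j, KPM.cheb k (hA.eigenvalues j)|
        ≤ 1 / (2 * ((2 * L : ℕ) : ℝ) ^ 2) * (m * n)) →
        KPM.W1 (KPM.spectralDensity hA) (KPM.densityMeasure (KPM.kpmDensity (2 * L) m O ω))
          ≤ ENNReal.ofReal ε := by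
      intro ω hω
      refine iSup₂_le fun f hf => ENNReal.ofReal_le_ofReal ?_
      rw [KPM.integral_spectralDensity, KPM.integral_densityMeasure (hmain ω).1]
      refine (le_abs_self _).trans (((hmain ω).2 hω f hf).trans ?_)
      have hL' : (0 : ℝ) < L := by exact_mod_cast hL
      push_cast at hN1
      rw [div_le_iff₀ hε] at hN1
      rw [div_le_iff₀ hL']
      linarith
    -- Subadditivity over the good and bad events replaces passing to a complement, so no
    -- measurability of the `W1` event is required.
    have hone : (1 : ENNReal) ≤ _ + _ :=
      (MeasureTheory.measure_univ (μ := KPM.coinLaw)).symm.le.trans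
        ((MeasureTheory.measure_mono fun ω _ => by
          by_cases h : ∀ k, 1 ≤ k → k ≤ 2 * L → |∑ i : Fin m, ∑ j,
            KPM.cheb k (hA.eigenvalues j) * KPM.signCoord hA.eigenvectorBasis ω i j ^ 2
              - m * ∑ j, KPM.cheb k (hA.eigenvalues j)|
            ≤ 1 / (2 * ((2 * L : ℕ) : ℝ) ^ 2) * (m * n)
          · exact Or.inl (hW ω h)
          · exact Or.inr h).trans (MeasureTheory.measure_union_le
            {ω | KPM.W1 (KPM.spectralDensity hA)
              (KPM.densityMeasure (KPM.kpmDensity (2 * L) m O ω)) ≤ ENNReal.ofReal ε} _))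
    rw [ENNReal.ofReal_sub _ hδ.le, ENNReal.ofReal_one]
    exact tsub_le_iff_right.2 (hone.trans (add_le_add le_rfl hbad))
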